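/- **Setting.** Let $X$ be a finite nonempty set, $\Delta,\Omega$ measurable spaces, and $F:X\times(\Delta\times\Omega)\to\mathbb R$ measurable in its second argument. A scenario $d=(\delta,\omega)$ is random: $\delta$ has law $P_\delta$ and, given $\delta$, $\omega$ has law $\kappa(\delta)$, such that for every fixed $\delta$ the family $(F(x,(\delta,\omega)))_{x\in X}$ is a centred Gaussian process with covariance kernel $k^\delta$. Let $N\ge 1$, $\rho>0$, $\varepsilon\in(0,1)$. Draw i.i.d. scenarios $D_N=\{d_1,\dots,d_N\}$, $d_i=(\delta_i,\omega_i)$, and, independently of them, i.i.d. noises $n_t\sim\mathcal N(0,\rho^2)$, $t\ge1$. Put $\beta_t=2\log\big(|X|\pi^2t^2/(3\varepsilon)\big)$. **Algorithm (Scenario-UCB).** For each $i$, let $\mu^i_t,\sigma^i_t$ be the Gaussian-process posterior mean and standard deviation for prior mean $0$, kernel $k^{\delta_i}$ and noise variance $\rho^2$, based on exactly the pairs $(x_s,y_s)$ with $s\le t$ and $i_s=i$: if these points are $a_1,\dots,a_m$ with observations $\mathbf y$, $K=[k^{\delta_i}(a_p,a_q)]_{p,q}$ and $\mathbf k(x)=[k^{\delta_i}(a_p,x)]_p$,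 then $\mu^i_t(x)=\mathbf k(x)^\top(K+\rho^2I)^{-1}\mathbf y$ and $\sigma^i_t(x)^2=k^{\delta_i}(x,x)-\mathbf k(x)^\top(K+\rho^2I)^{-1}\mathbf k(x)$. In round $t=1,2,\dots$ choose $$x_t\in\arg\max_{x\in X}\ \min_{1\le i\le N}\ \mu^i_{t-1}(x)+\sqrt{\beta_t}\,\sigma^i_{t-1}(x),\qquad i_t\in\arg\min_{1\le i\le N}\ \mu^i_{t-1}(x_t)+\sqrt{\beta_t}\,\sigma^i_{t-1}(x_t),$$ and observe $y_t=F(x_t,d_{i_t})+n_t$; ties are broken measurably, using only $\delta_1,\dots,\delta_N$ and $y_1,\dots,y_{t-1}$. Let $J(D_N)=\max_{x\in X}\min_{1\le i\le N}F(x,d_i)$, and define the scenario regret $$R_T^{\text{re-draw}}(D_N)=\frac1T\sum_{t=1}^T\big(J(D_N)-F(x_t,d_{i_t})\big).$$ For each $i$ let $\hat\lambda^i_1\ge\dots\ge\hat\lambda^i_{|X|}$ be the eigenvalues of the matrix $[k^{\delta_i}(x,x')]_{x,x'\in X}$, and let $v_i=\max\{1,\max_{x}k^{\delta_i}(x,x)\}$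 (so $v_i=1$ for kernels normalised by $k^{\delta_i}(x,x)\le1$). **Theorem (regret under re-draw).** There are numbers $\gamma^i_T$, depending only on $T$, $\rho$ and the kernel matrix of $k^{\delta_i}$ on $X$, such that the following holds with $\gamma_T=\sum_{i=1}^N\gamma_T^i$. 1. For every $T\ge1$, conditionally on $(\delta_1,\dots,\delta_N)$ (and hence also unconditionally), $$\mathbb P\left(R_T^{\text{re-draw}}(D_N)\le\sqrt{\frac{8\beta_T\gamma_T}{T\log(1+1/\rho^2)}}\right)\ge1-\varepsilon,$$ where $\gamma^i_T\in O\Big(\rho^{-2}\big(T\sum_{j\ge2}\hat\lambda^i_j+\log(T\sum_{j\ge1}\hat\lambda^i_j)\big)\Big)$. Precisely, for all $T\ge1$, $$\gamma^i_T\le C_1\,v_i\,\rho^{-2}\Big(T\sum_{j\ge2}\hat\lambda^i_j+\log\max\{2,\,T\textstyle\sum_{j\ge1}\hat\lambda^i_j\}\Big),$$ with a constant $C_1$ depending only on an upper bound for $\rho$. 2. For $T>|X|$ one has moreover $\gamma^i_T\in O\big(|X|\log(T\sum_{j\ge1}\hat\lambda^i_j)\big)$. Precisely, for all $T>|X|$,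 $$\gamma^i_T\le C_2\,v_i\,|X|\,\log\max\{2,\,T\textstyle\sum_{j\ge1}\hat\lambda^i_j\},$$ with a constant $C_2$ depending only on $\rho$. -/

import Mathlib

open MeasureTheory ProbabilityTheory Matrix

noncomputable section

namespace ScenarioUCB

/-! ### Gaussian-process posterior -/

section Posterior

variable {X : Type*}

/-- `K_A + ρ² I`, the regularised kernel matrix of the query points `pts s`, `s ∈ A`.
The rows are indexed by the observation times, so repeated query points are kept. -/
def regGram (K : Matrix X X ℝ) (ρ : ℝ) (A : Finset ℕ) (pts : ℕ → X) : Matrix A A ℝ :=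
  Matrix.of (fun s r : A => K (pts s) (pts r)) + ρ ^ 2 • (1 : Matrix A A ℝ)

/-- The vector `(K(x_s, x))_{s ∈ A}`. -/
def kernelVec (K : Matrix X X ℝ) (A : Finset ℕ) (pts : ℕ → X) (x : X) : A → ℝ :=
  fun s => K (pts s) x

/-- Posterior mean at `x` given the observations `y s` at the points `pts s`, `s ∈ A`. -/
def postMean (K : Matrix X X ℝ) (ρ : ℝ) (A : Finset ℕ) (pts : ℕ → X) (y : ℕ → ℝ) (x : X) : ℝ :=
  kernelVec K A pts x ⬝ᵥ ((regGram K ρ A pts)⁻¹ *ᵥ (fun s : A => y s))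

/-- Posterior covariance given observations at the points `pts s`, `s ∈ A`. -/
def postCov (K : Matrix X X ℝ) (ρ : ℝ) (A : Finset ℕ) (pts : ℕ → X) (x x' : X) : ℝ :=
  K x x' - kernelVec K A pts x ⬝ᵥ ((regGram K ρ A pts)⁻¹ *ᵥ kernelVec K A pts x')

/-- Posterior standard deviation. -/
def postStd (K : Matrix X X ℝ) (ρ : ℝ) (A : Finset ℕ) (pts : ℕ → X) (x : X) : ℝ :=
  √(postCov K ρ A pts x x)

end Posterior

/-! ### The algorithm -/

/-- The rounds among `1, …, t` in which scenario `i` was queried. -/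
def obsTimes {N : ℕ} (idx : ℕ → Fin N) (t : ℕ) (i : Fin N) : Finset ℕ :=
  (Finset.Icc 1 t).filter (fun s => idx s = i)

/-- `β_t = 2 log(|X| π² t² / (3 ε))`. -/
def beta (X : Type*) [Fintype X] (ε : ℝ) (t : ℕ) : ℝ :=
  2 * Real.log (Fintype.card X * Real.pi ^ 2 * (t : ℝ) ^ 2 / (3 * ε))

/-- The upper confidence bound `μ^i_t(x) + √b σ^i_t(x)`: the posterior of scenario `i` uses exactly
the observations of the rounds `s ≤ t` with `i_s = i`. -/
def ucb {X : Type*} {N : ℕ} (K : Fin N → Matrix X X ℝ) (ρ b : ℝ) (pts : ℕ → X)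
    (idx : ℕ → Fin N) (y : ℕ → ℝ) (t : ℕ) (i : Fin N) (x : X) : ℝ :=
  postMean (K i) ρ (obsTimes idx t i) pts y x + √b * postStd (K i) ρ (obsTimes idx t i) pts x

/-- `F(·, (δ, ω))` is, for each fixed `δ` and with `ω` drawn from `κ δ`, a centred Gaussian process
on `X` with covariance kernel `k δ`. -/
structure IsRobustGP {X Δ Ω : Type*} [MeasurableSpace Δ] [MeasurableSpace Ω]
    (F : X → Δ × Ω → ℝ) (k : Δ → Matrix X X ℝ) (κ : Kernel Δ Ω) : Prop where
  measurable : ∀ x, Measurable (F x)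
  gaussian : ∀ δ, IsGaussianProcess (fun x ω => F x (δ, ω)) (κ δ)
  mean_zero : ∀ δ x, ∫ ω, F x (δ, ω) ∂(κ δ) = 0
  covariance_eq : ∀ δ x x',
    covariance (fun ω => F x (δ, ω)) (fun ω => F x' (δ, ω)) (κ δ) = k δ x x'

/-- The scenarios `d_i = (δ_i, ω_i)`, `i = 1, …, N`, are i.i.d. (`δ_i` has law `Pδ` and `ω_i` has
conditional law `κ δ_i` given `δ_i`), the measurement noises are i.i.d. `𝓝(0, ρ²)`, and the noise
sequence is independent of the scenarios. -/
structure IsScenarioSample {Δ Ω S : Type*} [MeasurableSpace Δ] [MeasurableSpace Ω]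
    [MeasurableSpace S] (P : Measure S) (Pδ : Measure Δ) (κ : Kernel Δ Ω) (ρ : ℝ) {N : ℕ}
    (d : Fin N → S → Δ × Ω) (noise : ℕ → S → ℝ) : Prop where
  measurable_d : ∀ i, Measurable (d i)
  law_d : ∀ i, P.map (d i) = Pδ ⊗ₘ κ
  indep_d : iIndepFun d P
  measurable_noise : ∀ t, Measurable (noise t)
  law_noise : ∀ t, P.map (noise t) = gaussianReal 0 ⟨ρ ^ 2, sq_nonneg ρ⟩
  indep_noise : iIndepFun noise P
  indep : IndepFun (fun s i => d i s) (fun s t => noise t s) P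

/-- The information available before round `t`: the uncertain parameters (hence the kernels) of the
sampled scenarios, and the observations of the rounds `1, …, t - 1`. -/
abbrev history {Δ Ω S : Type*} [MeasurableSpace Δ] {N : ℕ} (d : Fin N → S → Δ × Ω)
    (y : ℕ → S → ℝ) (t : ℕ) : MeasurableSpace S :=
  MeasurableSpace.comap (fun s i => (d i s).1) MeasurableSpace.pi ⊔
    ⨆ r ∈ Finset.Ico 1 t, MeasurableSpace.comap (y r) (borel ℝ)

/-- The query points `x t`, scenario indices `idx t` and observations `y t` (rounds `t ≥ 1`) are
produced by the scenario upper confidence bound algorithm; ties are broken in an arbitrary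
(measurable) way that uses only the information available so far. -/
structure IsScenarioUCBRun {X Δ Ω S : Type*} [Fintype X] [MeasurableSpace Δ]
    (F : X → Δ × Ω → ℝ) (k : Δ → Matrix X X ℝ) (ρ ε : ℝ) {N : ℕ}
    (d : Fin N → S → Δ × Ω) (noise : ℕ → S → ℝ)
    (x : ℕ → S → X) (idx : ℕ → S → Fin N) (y : ℕ → S → ℝ) : Prop where
  adapted_x : ∀ t, 1 ≤ t → Measurable[history d y t, ⊤] (x t)
  adapted_idx : ∀ t, 1 ≤ t → Measurable[history d y t, ⊤] (idx t)
  argmax_x : ∀ t, 1 ≤ t → ∀ s, ∀ x' : X,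
    (⨅ i, ucb (fun i => k (d i s).1) ρ (beta X ε t) (x · s) (idx · s) (y · s) (t - 1) i x') ≤
      ⨅ i, ucb (fun i => k (d i s).1) ρ (beta X ε t) (x · s) (idx · s) (y · s) (t - 1) i (x t s)
  argmin_idx : ∀ t, 1 ≤ t → ∀ s, ∀ i : Fin N,
    ucb (fun i => k (d i s).1) ρ (beta X ε t) (x · s) (idx · s) (y · s) (t - 1) (idx t s) (x t s) ≤
      ucb (fun i => k (d i s).1) ρ (beta X ε t) (x · s) (idx · s) (y · s) (t - 1) i (x t s)
  observe : ∀ t, 1 ≤ t → ∀ s, y t s = F (x t s) (d (idx t s) s) + noise t s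

/-! ### Regret -/

/-- The value `J(D_N) = max_x min_i F(x, d_i)` of the sampled problem. -/
def scenarioValue {X D : Type*} {N : ℕ} (F : X → D → ℝ) (d : Fin N → D) : ℝ :=
  ⨆ x, ⨅ i, F x (d i)

/-- The scenario regret `R_T(D_N) = (1/T) ∑_{t=1}^T (J(D_N) - F(x_t, d_{i_t}))`. -/
def regret {X D : Type*} {N : ℕ} (F : X → D → ℝ) (d : Fin N → D) (x : ℕ → X)
    (idx : ℕ → Fin N) (T : ℕ) : ℝ :=
  1 / (T : ℝ) * ∑ t ∈ Finset.Icc 1 T, (scenarioValue F d - F (x t) (d (idx t)))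

/-! ### Spectral quantities of a kernel matrix -/

section Spectrum

variable {X : Type*} [Fintype X] [DecidableEq X] {K : Matrix X X ℝ}

/-- `∑_{j ≥ 1} λ_j`, where `λ_1 ≥ λ_2 ≥ …` are the eigenvalues of `K`. -/
def eigSum (hK : K.IsHermitian) : ℝ := ∑ j, hK.eigenvalues₀ j

/-- `∑_{j ≥ 2} λ_j`, all eigenvalues but the largest (the index `j` starts from `0` here). -/
def eigTail (hK : K.IsHermitian) : ℝ :=
  ∑ j ∈ Finset.univ.filter (fun j : Fin (Fintype.card X) => 1 ≤ (j : ℕ)), hK.eigenvalues₀ j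

end Spectrum

/-- `max {1, max_x K(x, x)}`; this is `1` for kernels normalised by `K(x, x) ≤ 1`. -/
def varFactor {X : Type*} (K : Matrix X X ℝ) : ℝ := max 1 (⨆ x, K x x)

end ScenarioUCB

end

/-!
The numbers `γ K T` are `varFactor K` times the maximal information gain `maxInfoGain K ρ T` of `T`
noisy observations of a Gaussian process with covariance `K`.

*Confidence.* In each round it is enough to have `|X| + 1` one-sided confidence bounds: for each point
`x₀` an upper bound for the scenario that minimises the upper confidence bound at `x₀`, and a lower
bound at the queried pair `(x_t, i_t)`; no union over the scenarios is needed. All these pairs are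
functions of the past. The queries being adaptive, the past is decomposed into the finitely many
possible paths of queries. Along a fixed path, and for fixed `δ_1, …, δ_N`, the observations and the
residual `F(x, d_i) - μ^i(x)` are jointly Gaussian and uncorrelated
(`IsNoisyGP.covariance_residual_pathObs`), hence independent, and the residual has the posterior
variance. Whether the run follows a path depends only on the `δ_i` and on the observations along that
path (`IsScenarioUCBRun.exists_path_event`), so the Gaussian tail bound survives multiplication with
this event. Summing over the paths gives `IsScenarioUCBRun.measure_exceeds_le`, and the choice of
`β_t` makes the failure probabilities add up to at most `ε`.

*Regret.* On the confidence event the regret of round `t` is at most `2 √β_t σ_t`, where `σ_t` is the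
posterior standard deviation at the query. By Schur complements the terms
`½ log (1 + σ_t² / ρ²)` of one scenario add up to its information gain
(`sum_log_postCov_eq_infoGain`), and Cauchy–Schwarz concludes (`regret_le_of_le_postStd`).

*Spectral bounds.* Sylvester's determinant identity and monotonicity of the determinant bound the
information gain by `½ ∑ log (1 + ρ⁻² T λ_j)` (`infoGain_le_sum_log_eigenvalues`). Bounding every term
by a logarithm gives the second estimate for `γ`, and bounding all terms but that of the largest
eigenvalue by `log (1 + u) ≤ u` gives the first.
-/

namespace ScenarioUCB

/-! ### Determinants of positive definite matrices -/

section Determinants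

variable {n : Type*} [Fintype n] [DecidableEq n]

theorem det_one_add_smul_eq_prod_eigenvalues {K : Matrix n n ℝ} (hK : K.IsHermitian) (c : ℝ) :
    (1 + c • K).det = ∏ j, (1 + c * hK.eigenvalues j) := by
  have hU : ((hK.eigenvectorUnitary : Matrix n n ℝ)) *
      star (hK.eigenvectorUnitary : Matrix n n ℝ) = 1 := by simp
  have h : 1 + c • K = (hK.eigenvectorUnitary : Matrix n n ℝ) *
      (1 + c • diagonal hK.eigenvalues) * star (hK.eigenvectorUnitary : Matrix n n ℝ) := by
    conv_lhs => rw [hK.spectral_theorem, Unitary.conjStarAlgAut_apply]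
    rw [mul_add, add_mul, mul_one, hU]
    simp
  rw [h, det_mul, det_mul, mul_right_comm, ← det_mul, hU, det_one, one_mul,
    ← diagonal_one, ← diagonal_smul, diagonal_add, det_diagonal]
  simp

theorem one_le_det_one_add_of_posSemidef {P : Matrix n n ℝ} (hP : P.PosSemidef) :
    1 ≤ (1 + P).det := by
  have h := det_one_add_smul_eq_prod_eigenvalues hP.isHermitian 1
  rw [one_smul] at h
  rw [h]
  calc (1 : ℝ) = ∏ _j : n, (1 : ℝ) := by simp
    _ ≤ _ := Finset.prod_le_prod (fun _ _ => zero_le_one) fun j _ => by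
      have := hP.eigenvalues_nonneg j
      linarith

theorem exists_eq_conjTranspose_mul_self {A : Matrix n n ℝ} (hA : A.PosSemidef) :
    ∃ B : Matrix n n ℝ, A = Bᴴ * B := by
  open scoped MatrixOrder in
  exact CStarAlgebra.nonneg_iff_eq_star_mul_self.mp hA.nonneg

/-- Writing `A = Cᴴ C` reduces the claim to `1 ≤ det (1 + Q)` with `Q = C⁻ᴴ P C⁻¹`. -/
theorem det_le_det_add_of_posSemidef {A P : Matrix n n ℝ} (hA : A.PosDef) (hP : P.PosSemidef) :
    A.det ≤ (A + P).det := by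
  obtain ⟨C, hC⟩ := exists_eq_conjTranspose_mul_self hA.posSemidef
  have hdet : A.det = C.det * C.det := by rw [hC, det_mul, det_conjTranspose]; simp
  have hCu : IsUnit C.det := by
    rw [isUnit_iff_ne_zero]
    rintro h0
    have := hA.det_pos
    rw [hdet, h0] at this
    simp at this
  have hQ := hP.conjTranspose_mul_mul_same C⁻¹
  have h : A + P = Cᴴ * (1 + C⁻¹ᴴ * P * C⁻¹) * C := by
    have h1 : Cᴴ * C⁻¹ᴴ = 1 := by
      rw [← conjTranspose_mul, nonsing_inv_mul _ hCu, conjTranspose_one]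
    rw [mul_add, add_mul, mul_one, ← hC, ← mul_assoc, ← mul_assoc, h1, one_mul,
      mul_assoc, nonsing_inv_mul _ hCu, mul_one]
  have h2 := one_le_det_one_add_of_posSemidef hQ
  rw [h, det_mul, det_mul, det_conjTranspose, hdet, star_trivial]
  nlinarith [mul_self_nonneg C.det]

end Determinants

/-! ### The posterior covariance as a Schur complement -/

section Posterior

variable {X : Type*} {K : Matrix X X ℝ} {ρ : ℝ}

theorem regGram_eq (K : Matrix X X ℝ) (ρ : ℝ) (A : Finset ℕ) (pts : ℕ → X) :
    regGram K ρ A pts = K.submatrix (fun s : A => pts s) (fun s : A => pts s) +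
      ρ ^ 2 • (1 : Matrix A A ℝ) := rfl

theorem posDef_regGram (hK : K.PosSemidef) (hρ : 0 < ρ) (A : Finset ℕ) (pts : ℕ → X) :
    (regGram K ρ A pts).PosDef := by
  rw [regGram_eq, add_comm]
  exact (Matrix.PosDef.one.smul (by positivity)).add_posSemidef (hK.submatrix _)

theorem postCov_le (hK : K.PosSemidef) (hρ : 0 < ρ) (A : Finset ℕ) (pts : ℕ → X) (x : X) :
    postCov K ρ A pts x x ≤ K x x := by
  have := (posDef_regGram hK hρ A pts).inv.posSemidef.dotProduct_mulVec_nonneg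
    (kernelVec K A pts x)
  simp only [star_trivial] at this
  unfold postCov
  linarith

/-- The posterior covariance at `x` is the Schur complement of the regularised kernel matrix in the
kernel matrix bordered by the point `x`. -/
theorem postCov_eq_schur (K : Matrix X X ℝ) (ρ : ℝ) (A : Finset ℕ) (pts : ℕ → X) (x : X) (c : ℝ) :
    (of fun _ _ : Unit => K x x + c) -
      (replicateCol Unit (kernelVec K A pts x))ᴴ * (regGram K ρ A pts)⁻¹ *
        replicateCol Unit (kernelVec K A pts x) =
      of fun _ _ : Unit => postCov K ρ A pts x x + c := by
  ext i j
  simp only [postCov, Matrix.sub_apply, of_apply, Matrix.mul_assoc]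
  rw [mul_apply]
  simp only [dotProduct, mulVec, mul_apply, conjTranspose_apply, replicateCol_apply, star_trivial]
  ring

theorem postCov_nonneg (hK : K.PosSemidef) (hρ : 0 < ρ) (A : Finset ℕ) (pts : ℕ → X) (x : X) :
    0 ≤ postCov K ρ A pts x x := by
  have hG := posDef_regGram hK hρ A pts
  have : Invertible (regGram K ρ A pts) := hG.isUnit.invertible
  have h : (fromBlocks (regGram K ρ A pts) (replicateCol Unit (kernelVec K A pts x))
      (replicateCol Unit (kernelVec K A pts x))ᴴ (of fun _ _ : Unit => K x x)).PosSemidef := by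
    have h1 := hK.submatrix (Sum.elim (fun s : A => pts s) (fun _ : Unit => x))
    have h2 : (diagonal (Sum.elim (fun _ : A => ρ ^ 2) (fun _ : Unit => (0 : ℝ)))).PosSemidef := by
      refine Matrix.PosSemidef.diagonal fun i => ?_
      rcases i with i | i
      · simp; positivity
      · simp
    convert h1.add h2 using 1
    have hsymm : ∀ a b, K a b = K b a := fun a b => by simpa using hK.isHermitian.apply b a
    ext (i | i) (j | j)
    · simp [regGram, one_apply, diagonal_apply]
    · simp [kernelVec]
    · simp [kernelVec, hsymm x (pts j)]
    · simp
  rw [hG.fromBlocks₁₁] at h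
  have h3 := postCov_eq_schur K ρ A pts x 0
  simp only [add_zero] at h3
  rw [h3] at h
  exact h.diag_nonneg (i := ())

/-- The determinant of the regularised kernel matrix gains the factor `ρ² + σ²` when a point with
posterior variance `σ²` is added. -/
theorem det_regGram_insert (hK : K.PosSemidef) (hρ : 0 < ρ) {A : Finset ℕ} {t : ℕ} (ht : t ∉ A)
    (pts : ℕ → X) :
    (regGram K ρ (insert t A) pts).det =
      (regGram K ρ A pts).det * (ρ ^ 2 + postCov K ρ A pts (pts t) (pts t)) := by
  have hG := posDef_regGram hK hρ A pts
  have : Invertible (regGram K ρ A pts) := hG.isUnit.invertible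
  have hsymm : ∀ a b, K a b = K b a := fun a b => by simpa using hK.isHermitian.apply b a
  let e : A ⊕ Unit ≃ (insert t A : Finset ℕ) :=
    (Equiv.optionEquivSumPUnit A).symm.trans (Finset.subtypeInsertEquivOption ht).symm
  have hel : ∀ a : A, ((e (Sum.inl a) : (insert t A : Finset ℕ)) : ℕ) = a := fun a => rfl
  have her : ∀ u : Unit, ((e (Sum.inr u) : (insert t A : Finset ℕ)) : ℕ) = t := fun a => rfl
  have hne : ∀ a : A, (a : ℕ) ≠ t := fun a h => ht (h ▸ a.2)
  have hone : ∀ (B : Finset ℕ) (i j : B), (1 : Matrix B B ℝ) i j =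
      if (i : ℕ) = j then 1 else 0 := fun B i j => by
    rw [one_apply]; exact if_congr Subtype.ext_iff rfl rfl
  have hblock : (regGram K ρ (insert t A) pts).submatrix e e =
      fromBlocks (regGram K ρ A pts) (replicateCol Unit (kernelVec K A pts (pts t)))
        (replicateCol Unit (kernelVec K A pts (pts t)))ᴴ
        (of fun _ _ : Unit => K (pts t) (pts t) + ρ ^ 2) := by
    ext (i | i) (j | j)
    · simp [regGram, hel, hone]
    · simp [regGram, hel, her, hone, hne i, kernelVec]
    · simp [regGram, hel, her, hone, (hne j).symm, kernelVec, hsymm (pts t) (pts j)]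
    · simp [regGram, her, hone]
  rw [← det_submatrix_equiv_self e, hblock, det_fromBlocks₁₁, invOf_eq_nonsing_inv,
    postCov_eq_schur]
  simp [add_comm]

end Posterior

/-! ### Information gain -/

section InformationGain

variable {X : Type*} {K : Matrix X X ℝ} {ρ : ℝ}

/-- The mutual information `½ log det (I + ρ⁻² K_A)` between a centred Gaussian process with
covariance `K` and its noisy observations at the points `pts s`, `s ∈ A`. -/
noncomputable def infoGain (K : Matrix X X ℝ) (ρ : ℝ) (A : Finset ℕ) (pts : ℕ → X) : ℝ :=
  1 / 2 * Real.log ((ρ ^ 2)⁻¹ • regGram K ρ A pts).det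

/-- The largest information gain of at most `T` observations. -/
noncomputable def maxInfoGain (K : Matrix X X ℝ) (ρ : ℝ) (T : ℕ) : ℝ :=
  ⨆ q : {A : Finset ℕ // A.card ≤ T} × (ℕ → X), infoGain K ρ q.1 q.2

theorem infoGain_empty (K : Matrix X X ℝ) (ρ : ℝ) (pts : ℕ → X) : infoGain K ρ ∅ pts = 0 := by
  simp [infoGain]

theorem infoGain_insert (hK : K.PosSemidef) (hρ : 0 < ρ) {A : Finset ℕ} {t : ℕ} (ht : t ∉ A)
    (pts : ℕ → X) :
    infoGain K ρ (insert t A) pts =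
      infoGain K ρ A pts + 1 / 2 * Real.log (1 + (ρ ^ 2)⁻¹ * postCov K ρ A pts (pts t) (pts t)) := by
  have h0 := postCov_nonneg hK hρ A pts (pts t)
  have hdet : ((ρ ^ 2)⁻¹ • regGram K ρ (insert t A) pts).det =
      ((ρ ^ 2)⁻¹ • regGram K ρ A pts).det *
        (1 + (ρ ^ 2)⁻¹ * postCov K ρ A pts (pts t) (pts t)) := by
    rw [det_smul, det_smul, det_regGram_insert hK hρ ht, Fintype.card_coe, Fintype.card_coe,
      Finset.card_insert_of_notMem ht, pow_succ]
    field_simp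
  have hpos : 0 < ((ρ ^ 2)⁻¹ • regGram K ρ A pts).det :=
    ((posDef_regGram hK hρ A pts).smul (by positivity)).det_pos
  rw [infoGain, hdet, Real.log_mul hpos.ne' (by positivity), mul_add, infoGain]

/-- Chain rule: the terms `½ log (1 + σ² / ρ²)` of the queries of scenario `i`, with `σ²` the posterior
variance before the query, add up to the information gain of that scenario. -/
theorem sum_log_postCov_eq_infoGain {N : ℕ} (hK : K.PosSemidef) (hρ : 0 < ρ) (pts : ℕ → X)
    (idx : ℕ → Fin N) (i : Fin N) (T : ℕ) :
    ∑ t ∈ (Finset.Icc 1 T).filter (fun t => idx t = i),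
      1 / 2 * Real.log (1 + (ρ ^ 2)⁻¹ *
        postCov K ρ (obsTimes idx (t - 1) i) pts (pts t) (pts t)) =
      infoGain K ρ (obsTimes idx T i) pts := by
  induction T with
  | zero => simp [obsTimes, infoGain_empty]
  | succ T ih =>
    have hIcc : Finset.Icc 1 (T + 1) = insert (T + 1) (Finset.Icc 1 T) := by
      ext; simp; omega
    have hmem : T + 1 ∉ obsTimes idx T i := by simp [obsTimes]
    by_cases h : idx (T + 1) = i
    · have hobs : obsTimes idx (T + 1) i = insert (T + 1) (obsTimes idx T i) := by
        rw [obsTimes, hIcc, Finset.filter_insert, if_pos h, obsTimes]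
      rw [hIcc, Finset.filter_insert, if_pos h, Finset.sum_insert (by simp), ih, hobs,
        infoGain_insert hK hρ hmem]
      simp [add_comm]
    · have hobs : obsTimes idx (T + 1) i = obsTimes idx T i := by
        rw [obsTimes, hIcc, Finset.filter_insert, if_neg h, obsTimes]
      rw [hIcc, Finset.filter_insert, if_neg h, ih, hobs]

section Spectral

variable [Fintype X] [DecidableEq X]

/-- Selecting points of `X` with multiplicity, at most `T` in total, increases the determinant no more
than taking every point of `X` with multiplicity `T`. -/
theorem det_one_add_gram_le {m : Type*} [Fintype m] [DecidableEq m] (hK : K.PosSemidef) {c : ℝ}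
    (hc : 0 ≤ c) (f : m → X) {T : ℝ} (hT : Fintype.card m ≤ T) :
    (1 + c • K.submatrix f f).det ≤ (1 + (c * T) • K).det := by
  obtain ⟨B, hB⟩ := exists_eq_conjTranspose_mul_self hK
  -- The columns of `V` are the columns of `B` at the points `f i`, so that `V Vᴴ` weighs each
  -- column of `B` with the number of times it is selected, which is at most `T`.
  set V : Matrix X m ℝ := B.submatrix id f with hV
  have h1 : K.submatrix f f = Vᴴ * V := by
    rw [hB]; ext i j; simp [hV, mul_apply]
  have h2 : (1 + c • K.submatrix f f).det = (1 + c • (V * Vᴴ)).det := by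
    rw [h1, ← Matrix.smul_mul, det_one_add_mul_comm, Matrix.mul_smul]
  have h3 : (1 + (c * T) • K).det = (1 + (c * T) • (B * Bᴴ)).det := by
    rw [hB, ← Matrix.smul_mul, det_one_add_mul_comm, Matrix.mul_smul]
  have h4 : (1 + c • (V * Vᴴ)).PosDef :=
    PosDef.one.add_posSemidef ((posSemidef_self_mul_conjTranspose V).smul hc)
  have h5 : V * Vᴴ = B * diagonal (fun x => ((Finset.univ.filter fun i => f i = x).card : ℝ)) *
      Bᴴ := by
    ext a b
    rw [mul_apply, mul_apply]
    simp only [mul_diagonal, conjTranspose_apply, star_trivial, hV, submatrix_apply, id]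
    rw [← Finset.sum_fiberwise (s := Finset.univ) (g := f)]
    refine Finset.sum_congr rfl fun x _ => ?_
    rw [Finset.sum_congr rfl (g := fun _ => B a x * B b x), Finset.sum_const, nsmul_eq_mul]
    · ring
    · intro i hi
      rw [(Finset.mem_filter.mp hi).2]
  have h6 : (T • (B * Bᴴ) - V * Vᴴ).PosSemidef := by
    have : T • (B * Bᴴ) - V * Vᴴ =
        B * diagonal (fun x => T - ((Finset.univ.filter fun i => f i = x).card : ℝ)) * Bᴴ := by
      have hd : diagonal (fun x => T - ((Finset.univ.filter fun i => f i = x).card : ℝ)) =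
          T • (1 : Matrix X X ℝ) -
            diagonal (fun x => ((Finset.univ.filter fun i => f i = x).card : ℝ)) := by
        rw [← diagonal_one, ← diagonal_smul, diagonal_sub]
        simp
      rw [hd, mul_sub, sub_mul, h5]
      simp
    rw [this]
    refine (PosSemidef.diagonal fun x => ?_).mul_mul_conjTranspose_same B
    have : (Finset.univ.filter fun i => f i = x).card ≤ Fintype.card m := Finset.card_le_univ _
    have : ((Finset.univ.filter fun i => f i = x).card : ℝ) ≤ Fintype.card m := by
      exact_mod_cast this
    simp only [Pi.zero_apply]
    linarith
  have h7 := det_le_det_add_of_posSemidef h4 (h6.smul hc)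
  rw [h2, h3]
  convert h7 using 2
  rw [add_assoc, ← smul_add, add_sub_cancel, smul_smul]

theorem infoGain_le_sum_log_eigenvalues (hK : K.PosSemidef) (hρ : 0 < ρ) (A : Finset ℕ)
    (pts : ℕ → X) {T : ℕ} (hA : A.card ≤ T) :
    infoGain K ρ A pts ≤
      1 / 2 * ∑ j, Real.log (1 + (ρ ^ 2)⁻¹ * T * hK.isHermitian.eigenvalues₀ j) := by
  have hpos : 0 < ((ρ ^ 2)⁻¹ • regGram K ρ A pts).det :=
    ((posDef_regGram hK hρ A pts).smul (by positivity)).det_pos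
  have h1 : (ρ ^ 2)⁻¹ • regGram K ρ A pts =
      1 + (ρ ^ 2)⁻¹ • K.submatrix (fun s : A => pts s) (fun s : A => pts s) := by
    rw [regGram_eq, smul_add, smul_smul, inv_mul_cancel₀ (by positivity), one_smul, add_comm]
  have h2 := det_one_add_gram_le hK (c := (ρ ^ 2)⁻¹) (by positivity) (fun s : A => pts s)
    (T := T) (by rw [Fintype.card_coe]; exact_mod_cast hA)
  rw [det_one_add_smul_eq_prod_eigenvalues hK.isHermitian] at h2
  rw [infoGain]
  gcongr
  refine (Real.log_le_log hpos (h1 ▸ h2)).trans ?_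
  have hne : ∀ j, 1 + (ρ ^ 2)⁻¹ * T * hK.isHermitian.eigenvalues j ≠ 0 := fun j => by
    have := hK.eigenvalues_nonneg j
    positivity
  rw [Real.log_prod fun j _ => hne j]
  refine le_of_eq ?_
  exact Equiv.sum_comp (Fintype.equivOfCardEq (Fintype.card_fin (Fintype.card X))).symm
    (fun j => Real.log (1 + (ρ ^ 2)⁻¹ * T * hK.isHermitian.eigenvalues₀ j))

theorem eigenvalues₀_nonneg (hK : K.PosSemidef) (j : Fin (Fintype.card X)) :
    0 ≤ hK.isHermitian.eigenvalues₀ j := by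
  have := hK.eigenvalues_nonneg ((Fintype.equivOfCardEq (Fintype.card_fin _)) j)
  simpa [IsHermitian.eigenvalues] using this

/-- The supremum is over an infinite set of query sequences; it is bounded by the spectral bound. -/
theorem infoGain_le_maxInfoGain (hK : K.PosSemidef) (hρ : 0 < ρ) (A : Finset ℕ)
    (pts : ℕ → X) {T : ℕ} (hA : A.card ≤ T) : infoGain K ρ A pts ≤ maxInfoGain K ρ T :=
  le_ciSup (f := fun q : {A : Finset ℕ // A.card ≤ T} × (ℕ → X) => infoGain K ρ q.1 q.2)
    ⟨_, Set.forall_mem_range.mpr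
      fun q => infoGain_le_sum_log_eigenvalues hK hρ q.1 q.2 q.1.2⟩ (⟨A, hA⟩, pts)

theorem maxInfoGain_le [Nonempty X] (hK : K.PosSemidef) (hρ : 0 < ρ) (T : ℕ) :
    maxInfoGain K ρ T ≤
      1 / 2 * ∑ j, Real.log (1 + (ρ ^ 2)⁻¹ * T * hK.isHermitian.eigenvalues₀ j) := by
  have : Nonempty ({A : Finset ℕ // A.card ≤ T} × (ℕ → X)) :=
    ⟨(⟨∅, by simp⟩, fun _ => Classical.arbitrary X)⟩
  exact ciSup_le fun q => infoGain_le_sum_log_eigenvalues hK hρ q.1 q.2 q.1.2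

theorem eigenvalue_le_eigSum (hK : K.PosSemidef) (j : Fin (Fintype.card X)) :
    hK.isHermitian.eigenvalues₀ j ≤ eigSum hK.isHermitian :=
  Finset.single_le_sum (f := hK.isHermitian.eigenvalues₀)
    (fun j _ => eigenvalues₀_nonneg hK j) (Finset.mem_univ j)

theorem eigTail_nonneg (hK : K.PosSemidef) : 0 ≤ eigTail hK.isHermitian :=
  Finset.sum_nonneg fun j _ => eigenvalues₀_nonneg hK j

theorem log_one_add_mul_le {a τ M : ℝ} (ha : 0 ≤ a) (hτ : 0 ≤ τ) (hM : 1 ≤ M) (h : τ ≤ M) :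
    Real.log (1 + a * τ) ≤ Real.log (1 + a) + Real.log M := by
  rw [← Real.log_mul (by positivity) (by positivity)]
  refine Real.log_le_log (by positivity) ?_
  nlinarith [mul_le_mul_of_nonneg_left h ha]

theorem log_one_add_mul_eigenvalue_le (hK : K.PosSemidef) {a : ℝ} (ha : 0 ≤ a) (T : ℕ)
    (j : Fin (Fintype.card X)) :
    Real.log (1 + a * T * hK.isHermitian.eigenvalues₀ j) ≤
      Real.log (1 + a) + Real.log (max 2 (T * eigSum hK.isHermitian)) := by
  have h0 := eigenvalues₀_nonneg hK j
  rw [mul_assoc]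
  refine log_one_add_mul_le ha (by positivity) (le_max_of_le_left one_le_two)
    (le_max_of_le_right ?_)
  gcongr
  exact eigenvalue_le_eigSum hK j

theorem log_two_le_log_max (M : ℝ) : Real.log 2 ≤ Real.log (max 2 M) :=
  Real.log_le_log two_pos (le_max_left _ _)

theorem maxInfoGain_le_card_mul_log [Nonempty X] (hK : K.PosSemidef) (hρ : 0 < ρ) (T : ℕ) :
    maxInfoGain K ρ T ≤ (Real.log (1 + (ρ ^ 2)⁻¹) / Real.log 2 + 1) *
      (Fintype.card X * Real.log (max 2 (T * eigSum hK.isHermitian))) := by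
  set L := Real.log (max 2 (T * eigSum hK.isHermitian)) with hL
  have hL2 : Real.log 2 ≤ L := log_two_le_log_max _
  have h2 : 0 < Real.log 2 := Real.log_pos one_lt_two
  have ha : 0 ≤ Real.log (1 + (ρ ^ 2)⁻¹) := Real.log_nonneg (by simp; positivity)
  have hb : Real.log (1 + (ρ ^ 2)⁻¹) ≤ Real.log (1 + (ρ ^ 2)⁻¹) / Real.log 2 * L := by
    rw [div_mul_eq_mul_div, le_div_iff₀ h2]
    gcongr
  have hsum : ∑ j, Real.log (1 + (ρ ^ 2)⁻¹ * T * hK.isHermitian.eigenvalues₀ j) ≤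
      ∑ _j : Fin (Fintype.card X), (Real.log (1 + (ρ ^ 2)⁻¹) / Real.log 2 + 1) * L :=
    Finset.sum_le_sum fun j _ =>
      (log_one_add_mul_eigenvalue_le hK (by positivity) T j).trans (by linarith)
  have hnn : 0 ≤ ∑ _j : Fin (Fintype.card X), (Real.log (1 + (ρ ^ 2)⁻¹) / Real.log 2 + 1) * L := by
    have : 0 ≤ L := h2.le.trans hL2
    positivity
  have := maxInfoGain_le hK hρ T
  simp only [Finset.sum_const, Finset.card_univ, Fintype.card_fin, nsmul_eq_mul] at hsum hnn
  linarith

/-- The upper bound `ρ₀` on the noise is needed to absorb `log M` into `ρ⁻² log M`. -/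
theorem maxInfoGain_le_eigTail_add_log [Nonempty X] (hK : K.PosSemidef) (hρ : 0 < ρ) {ρ₀ : ℝ}
    (hρ₀ : ρ ≤ ρ₀) (T : ℕ) :
    maxInfoGain K ρ T ≤ (1 + (Real.log 2)⁻¹ + ρ₀ ^ 2) * (ρ⁻¹ ^ 2 *
      (T * eigTail hK.isHermitian + Real.log (max 2 (T * eigSum hK.isHermitian)))) := by
  set L := Real.log (max 2 (T * eigSum hK.isHermitian)) with hL
  set a := (ρ ^ 2)⁻¹ with ha
  have ha0 : 0 < a := by positivity
  have hL2 : Real.log 2 ≤ L := log_two_le_log_max _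
  have h2 : 0 < Real.log 2 := Real.log_pos one_lt_two
  have hL0 : 0 < L := h2.trans_le hL2
  have htail := eigTail_nonneg hK
  have ha1 : 1 ≤ ρ₀ ^ 2 * a := by
    rw [ha, ← div_eq_mul_inv, one_le_div (by positivity)]
    gcongr
  have hlog : Real.log (1 + a) ≤ a := by
    have := Real.log_le_sub_one_of_pos (show 0 < 1 + a by positivity)
    linarith
  -- The largest eigenvalue contributes a logarithm, the others are bounded by `log (1 + u) ≤ u`.
  have hsplit : ∑ j, Real.log (1 + a * T * hK.isHermitian.eigenvalues₀ j) ≤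
      (a + L) + a * (T * eigTail hK.isHermitian) := by
    rw [← Finset.sum_filter_not_add_sum_filter Finset.univ
      (fun j : Fin (Fintype.card X) => 1 ≤ (j : ℕ))]
    refine add_le_add ?_ ?_
    · have hsing : Finset.univ.filter (fun j : Fin (Fintype.card X) => ¬ 1 ≤ (j : ℕ)) =
          {⟨0, Fintype.card_pos⟩} := by
        ext j
        rw [Finset.mem_filter, Finset.mem_singleton, Fin.ext_iff]
        simp
      rw [hsing, Finset.sum_singleton]
      exact (log_one_add_mul_eigenvalue_le hK ha0.le T _).trans (by linarith)
    · rw [← mul_assoc, eigTail, Finset.mul_sum]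
      refine Finset.sum_le_sum fun j _ => ?_
      have h0 := eigenvalues₀_nonneg hK j
      have := Real.log_le_sub_one_of_pos
        (show 0 < 1 + a * T * hK.isHermitian.eigenvalues₀ j by positivity)
      linarith
  have h3 : a ≤ (Real.log 2)⁻¹ * a * L := by
    rw [mul_assoc, inv_mul_eq_div, le_div_iff₀ h2]
    gcongr
  have h4 : L ≤ ρ₀ ^ 2 * a * L := le_mul_of_one_le_left hL0.le ha1
  have h5 : 0 ≤ a * (T * eigTail hK.isHermitian) := by positivity
  have h6 : 0 ≤ (Real.log 2)⁻¹ * (a * (T * eigTail hK.isHermitian)) := by positivity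
  have h7 : 0 ≤ ρ₀ ^ 2 * (a * (T * eigTail hK.isHermitian)) := by positivity
  have h8 : 0 ≤ a * L := by positivity
  have := maxInfoGain_le hK hρ T
  have hinv : ρ⁻¹ ^ 2 = a := by rw [ha, inv_pow]
  rw [hinv]
  nlinarith

end Spectral

/-! ### Posterior variances and information gain -/

/-- The bound `s ≤ v log (1 + a s) / log (1 + a)` for `0 ≤ s ≤ v` and `1 ≤ v`, by concavity of the
logarithm. -/
theorem mul_log_one_add_le {a s v : ℝ} (ha : 0 ≤ a) (hs : 0 ≤ s) (hsv : s ≤ v) (hv : 1 ≤ v) :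
    s * Real.log (1 + a) ≤ v * Real.log (1 + a * s) := by
  have hv0 : 0 < v := by linarith
  have h1 := rpow_one_add_le_one_add_mul_self (s := a) (by linarith) (p := s / v) (by positivity)
    ((div_le_one hv0).mpr hsv)
  have h2 : 1 + s / v * a ≤ 1 + a * s := by
    have : s / v ≤ s := div_le_self hs hv
    nlinarith
  have h3 := Real.log_le_log (by positivity) (h1.trans h2)
  rw [Real.log_rpow (by positivity)] at h3
  calc s * Real.log (1 + a) = v * (s / v * Real.log (1 + a)) := by field_simp
    _ ≤ _ := by gcongr

theorem le_varFactor [Finite X] (K : Matrix X X ℝ) (x : X) : K x x ≤ varFactor K :=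
  le_max_of_le_right (le_ciSup (f := fun x => K x x) (Set.finite_range _).bddAbove x)

theorem one_le_varFactor (K : Matrix X X ℝ) : 1 ≤ varFactor K := le_max_left _ _

theorem postStd_sq (hK : K.PosSemidef) (hρ : 0 < ρ) (A : Finset ℕ) (pts : ℕ → X) (x : X) :
    postStd K ρ A pts x ^ 2 = postCov K ρ A pts x x :=
  Real.sq_sqrt (postCov_nonneg hK hρ A pts x)

/-- The squared widths of the confidence bands at the queries add up to at most
`2 ∑ i, v_i γ_i / log (1 + ρ⁻²)`, with `γ_i` the maximal information gain of scenario `i`. -/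
theorem sum_postStd_sq_le [Fintype X] [DecidableEq X] {N : ℕ} {K : Fin N → Matrix X X ℝ}
    (hK : ∀ i, (K i).PosSemidef) (hρ : 0 < ρ) (pts : ℕ → X) (idx : ℕ → Fin N) (T : ℕ) :
    (∑ t ∈ Finset.Icc 1 T,
      postStd (K (idx t)) ρ (obsTimes idx (t - 1) (idx t)) pts (pts t) ^ 2) *
        Real.log (1 + 1 / ρ ^ 2) ≤ 2 * ∑ i, varFactor (K i) * maxInfoGain (K i) ρ T := by
  rw [← Finset.sum_fiberwise (s := Finset.Icc 1 T) (g := idx), Finset.sum_mul, Finset.mul_sum]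
  refine Finset.sum_le_sum fun i _ => ?_
  have hcard : (obsTimes idx T i).card ≤ T :=
    (Finset.card_filter_le _ _).trans (by simp)
  have h1 := infoGain_le_maxInfoGain (hK i) hρ (obsTimes idx T i) pts hcard
  rw [← sum_log_postCov_eq_infoGain (hK i) hρ, ← Finset.mul_sum] at h1
  have hv := one_le_varFactor (K i)
  calc _ ≤ ∑ t ∈ (Finset.Icc 1 T).filter (fun t => idx t = i), varFactor (K i) *
        Real.log (1 + (ρ ^ 2)⁻¹ *
          postCov (K i) ρ (obsTimes idx (t - 1) i) pts (pts t) (pts t)) := by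
        rw [Finset.sum_mul]
        refine Finset.sum_le_sum fun t ht => ?_
        rw [(Finset.mem_filter.mp ht).2, postStd_sq (hK i) hρ, one_div]
        exact mul_log_one_add_le (by positivity) (postCov_nonneg (hK i) hρ _ _ _)
          ((postCov_le (hK i) hρ _ _ _).trans (le_varFactor _ _)) hv
    _ ≤ _ := by
        rw [← Finset.mul_sum]
        nlinarith

end InformationGain

/-! ### Gaussian posteriors along a fixed sequence of queries -/

/-- The strict inequality makes the bound hold for variance `0` too. -/
theorem gaussian_tail_le {Θ : Type*} [MeasurableSpace Θ] {Q : Measure Θ} {Z : Θ → ℝ}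
    (hZ : HasGaussianLaw Z Q) (h0 : ∫ θ, Z θ ∂Q = 0) {v b : ℝ} (hv : Var[Z; Q] = v)
    (hb : 0 ≤ b) : Q {θ | √b * √v < Z θ} ≤ ENNReal.ofReal (Real.exp (-(b / 2))) := by
  have := hZ.isProbabilityMeasure
  have hv0 : 0 ≤ v := hv ▸ variance_nonneg _ _
  have hmap := hZ.map_eq_gaussianReal
  rw [h0, hv] at hmap
  rcases hv0.eq_or_lt with rfl | hpos
  · have hnull : Q {θ | √b * √(0 : ℝ) < Z θ} = 0 := by
      have h1 : {θ | √b * √(0 : ℝ) < Z θ} = Z ⁻¹' Set.Ioi 0 := by ext; simp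
      rw [h1, ← Measure.map_apply_of_aemeasurable hZ.aemeasurable measurableSet_Ioi, hmap]
      simp
    rw [hnull]
    exact zero_le
  · have hmgf : mgf Z Q = fun t => Real.exp (v * t ^ 2 / 2) := by
      ext t
      rw [mgf_gaussianReal hmap]
      simp [hv0]
    have hint : ∀ t, Integrable (fun θ => Real.exp (t * Z θ)) Q := fun t => by
      have h := integrable_exp_mul_gaussianReal (μ := 0) (v := v.toNNReal) t
      rw [← hmap] at h
      exact (integrable_map_measure h.aestronglyMeasurable hZ.aemeasurable).mp h
    have hsub : HasSubgaussianMGF Z v.toNNReal Q :=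
      ⟨hint, fun t => by rw [hmgf]; simp [hv0]⟩
    have h1 := hsub.measure_ge_le (ε := √b * √v) (by positivity)
    rw [Measure.real, ← ENNReal.le_ofReal_iff_toReal_le (by simp) (by positivity)] at h1
    have hsubset : {θ | √b * √v < Z θ} ⊆ {θ | √b * √v ≤ Z θ} := fun θ hθ =>
      le_of_lt (a := √b * √v) (b := Z θ) hθ
    refine (measure_mono hsubset).trans (h1.trans_eq ?_)
    rw [mul_pow, Real.sq_sqrt hb, Real.sq_sqrt hv0, Real.coe_toNNReal _ hv0]
    congr 2
    field_simp

variable {X Θ : Type*} {N : ℕ}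

/-- Under `Q`, the functions `f i`, `i < N`, are independent centred Gaussian processes on `X` with
covariance matrices `K i`, and `n` is an independent Gaussian white noise of variance `ρ²`. -/
structure IsNoisyGP [MeasurableSpace Θ] (Q : Measure Θ) (f : Fin N → X → Θ → ℝ) (n : ℕ → Θ → ℝ)
    (K : Fin N → Matrix X X ℝ) (ρ : ℝ) : Prop where
  gaussian_f : ∀ i, HasGaussianLaw (fun θ x => f i x θ) Q
  indep_f : iIndepFun (fun i θ x => f i x θ) Q
  integral_f : ∀ i x, ∫ θ, f i x θ ∂Q = 0
  covariance_f : ∀ i x x', cov[f i x, f i x'; Q] = K i x x'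
  map_n : ∀ t, Q.map (n t) = gaussianReal 0 (ρ ^ 2).toNNReal
  aemeasurable_n : ∀ t, AEMeasurable (n t) Q
  indep_n : iIndepFun n Q
  indep : IndepFun (fun θ i x => f i x θ) (fun θ t => n t θ) Q

namespace IsNoisyGP

variable [MeasurableSpace Θ] {Q : Measure Θ} {f : Fin N → X → Θ → ℝ} {n : ℕ → Θ → ℝ}
  {K : Fin N → Matrix X X ℝ} {ρ : ℝ}

theorem gaussian_n (h : IsNoisyGP Q f n K ρ) (t : ℕ) : HasGaussianLaw (n t) Q :=
  ⟨by rw [h.map_n]; infer_instance⟩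

theorem memLp_f (h : IsNoisyGP Q f n K ρ) (i : Fin N) (x : X) : MemLp (f i x) 2 Q :=
  ((h.gaussian_f i).eval x).memLp_two

theorem memLp_n (h : IsNoisyGP Q f n K ρ) (t : ℕ) : MemLp (n t) 2 Q := (h.gaussian_n t).memLp_two

theorem integral_n (h : IsNoisyGP Q f n K ρ) (t : ℕ) : ∫ θ, n t θ ∂Q = 0 := by
  have := integral_id_gaussianReal (μ := 0) (v := (ρ ^ 2).toNNReal)
  rw [← h.map_n t, integral_map (h.aemeasurable_n t) (by fun_prop)] at this
  exact this

theorem covariance_ff (h : IsNoisyGP Q f n K ρ) (i j : Fin N) (x x' : X) :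
    cov[f i x, f j x'; Q] = if i = j then K i x x' else 0 := by
  split_ifs with hij
  · subst hij; exact h.covariance_f i x x'
  · exact ((h.indep_f.indepFun hij).comp (measurable_pi_apply x)
      (measurable_pi_apply x')).covariance_eq_zero (h.memLp_f i x) (h.memLp_f j x')

theorem covariance_fn (h : IsNoisyGP Q f n K ρ) (i : Fin N) (x : X) (t : ℕ) :
    cov[f i x, n t; Q] = 0 :=
  (h.indep.comp (φ := fun g : Fin N → X → ℝ => g i x) (ψ := fun g : ℕ → ℝ => g t)
    (by fun_prop) (by fun_prop)).covariance_eq_zero (h.memLp_f i x) (h.memLp_n t)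

theorem covariance_nn (h : IsNoisyGP Q f n K ρ) (s t : ℕ) :
    cov[n s, n t; Q] = if s = t then ρ ^ 2 else 0 := by
  split_ifs with hst
  · subst hst
    rw [covariance_self (h.aemeasurable_n s), ← variance_id_map (h.aemeasurable_n s), h.map_n,
      variance_id_gaussianReal, Real.coe_toNNReal _ (sq_nonneg ρ)]
  · exact (h.indep_n.indepFun hst).covariance_eq_zero (h.memLp_n s) (h.memLp_n t)

theorem jointly_gaussian [Fintype X] (h : IsNoisyGP Q f n K ρ) (I : Finset ℕ) :
    HasGaussianLaw (fun θ => ((fun i x => f i x θ), fun s : I => n s θ)) Q := by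
  refine IndepFun.hasGaussianLaw (iIndepFun.hasGaussianLaw h.gaussian_f h.indep_f)
    (iIndepFun.hasGaussianLaw (fun s => h.gaussian_n s)
      (h.indep_n.precomp Subtype.val_injective)) ?_
  exact h.indep.comp (φ := id) (ψ := fun (g : ℕ → ℝ) (s : I) => g s) measurable_id (by fun_prop)

end IsNoisyGP

/-- The observation at time `s` when the queries follow the fixed sequence `pts`, `idx`. -/
def pathObs (f : Fin N → X → Θ → ℝ) (n : ℕ → Θ → ℝ) (pts : ℕ → X) (idx : ℕ → Fin N) (s : ℕ)
    (θ : Θ) : ℝ := f (idx s) (pts s) θ + n s θ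

/-- The difference between `f i x` and its posterior mean given the observations at times
`1, …, t` along the fixed sequence `pts`, `idx`. -/
noncomputable def residual (f : Fin N → X → Θ → ℝ) (n : ℕ → Θ → ℝ) (K : Fin N → Matrix X X ℝ)
    (ρ : ℝ) (pts : ℕ → X) (idx : ℕ → Fin N) (t : ℕ) (i : Fin N) (x : X) (θ : Θ) : ℝ :=
  f i x θ - postMean (K i) ρ (obsTimes idx t i) pts (fun s => pathObs f n pts idx s θ) x

/-- The weights with which the observations enter the posterior mean. -/
noncomputable def postWeight (K : Matrix X X ℝ) (ρ : ℝ) (A : Finset ℕ) (pts : ℕ → X) (x : X) :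
    A → ℝ := kernelVec K A pts x ᵥ* (regGram K ρ A pts)⁻¹

theorem postMean_eq_sum (K : Matrix X X ℝ) (ρ : ℝ) (A : Finset ℕ) (pts : ℕ → X) (y : ℕ → ℝ)
    (x : X) : postMean K ρ A pts y x = ∑ s : A, postWeight K ρ A pts x s * y s := by
  rw [postMean, dotProduct_mulVec]; rfl

theorem residual_eq (f : Fin N → X → Θ → ℝ) (n : ℕ → Θ → ℝ) (K : Fin N → Matrix X X ℝ)
    (ρ : ℝ) (pts : ℕ → X) (idx : ℕ → Fin N) (t : ℕ) (i : Fin N) (x : X) :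
    residual f n K ρ pts idx t i x = fun θ => f i x θ -
      ∑ s : obsTimes idx t i, postWeight (K i) ρ (obsTimes idx t i) pts x s *
        pathObs f n pts idx s θ := by
  ext θ; rw [residual, postMean_eq_sum]

/-- The normal equations of the posterior mean. -/
theorem postWeight_vecMul_regGram {K : Matrix X X ℝ} {ρ : ℝ} (hK : K.PosSemidef) (hρ : 0 < ρ)
    (A : Finset ℕ) (pts : ℕ → X) (x : X) :
    postWeight K ρ A pts x ᵥ* regGram K ρ A pts = kernelVec K A pts x := by
  rw [postWeight, vecMul_vecMul,
    nonsing_inv_mul _ (posDef_regGram hK hρ A pts).det_pos.ne'.isUnit, vecMul_one]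

namespace IsNoisyGP

variable [MeasurableSpace Θ] {Q : Measure Θ} {f : Fin N → X → Θ → ℝ} {n : ℕ → Θ → ℝ}
  {K : Fin N → Matrix X X ℝ} {ρ : ℝ} {pts : ℕ → X} {idx : ℕ → Fin N}

theorem memLp_pathObs (h : IsNoisyGP Q f n K ρ) (s : ℕ) : MemLp (pathObs f n pts idx s) 2 Q :=
  (h.memLp_f _ _).add (h.memLp_n s)

theorem covariance_residual (h : IsNoisyGP Q f n K ρ) (t : ℕ) (i : Fin N) (x : X)
    {Y : Θ → ℝ} (hY : MemLp Y 2 Q) :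
    cov[residual f n K ρ pts idx t i x, Y; Q] = cov[f i x, Y; Q] -
      ∑ s : obsTimes idx t i, postWeight (K i) ρ (obsTimes idx t i) pts x s *
        cov[pathObs f n pts idx s, Y; Q] := by
  have := (h.gaussian_n 0).isProbabilityMeasure
  rw [residual_eq, covariance_fun_sub_left (h.memLp_f i x) _ hY, covariance_fun_sum_left _ hY]
  · simp_rw [covariance_const_mul_left]
  · exact fun s => (h.memLp_pathObs _).const_mul _
  · exact memLp_finsetSum _ fun s _ => (h.memLp_pathObs _).const_mul _

theorem covariance_pathObs_left (h : IsNoisyGP Q f n K ρ) (s : ℕ) {Y : Θ → ℝ}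
    (hY : MemLp Y 2 Q) :
    cov[pathObs f n pts idx s, Y; Q] = cov[f (idx s) (pts s), Y; Q] + cov[n s, Y; Q] := by
  have := (h.gaussian_n 0).isProbabilityMeasure
  exact covariance_add_left (h.memLp_f _ _) (h.memLp_n s) hY

theorem covariance_f_pathObs (h : IsNoisyGP Q f n K ρ) (i : Fin N) (x : X) (s : ℕ) :
    cov[f i x, pathObs f n pts idx s; Q] = if i = idx s then K i x (pts s) else 0 := by
  rw [covariance_comm, h.covariance_pathObs_left s (h.memLp_f i x), covariance_comm,
    covariance_comm (n s), h.covariance_ff, h.covariance_fn, add_zero]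

theorem covariance_pathObs (h : IsNoisyGP Q f n K ρ) (r s : ℕ) :
    cov[pathObs f n pts idx r, pathObs f n pts idx s; Q] =
      (if idx r = idx s then K (idx r) (pts r) (pts s) else 0) + if r = s then ρ ^ 2 else 0 := by
  rw [h.covariance_pathObs_left r (h.memLp_pathObs s), h.covariance_f_pathObs,
    covariance_comm, h.covariance_pathObs_left s (h.memLp_n r), h.covariance_fn, h.covariance_nn,
    zero_add]
  simp_rw [eq_comm (a := s)]

/-- The residual is uncorrelated with all observations: those of other scenarios are independent of
`f i`, and those of scenario `i` are accounted for by the normal equations of the posterior. -/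
theorem covariance_residual_pathObs (h : IsNoisyGP Q f n K ρ) (hK : ∀ i, (K i).PosSemidef)
    (hρ : 0 < ρ) (t : ℕ) (i : Fin N) (x : X) {s : ℕ} (hs : s ∈ Finset.Icc 1 t) :
    cov[residual f n K ρ pts idx t i x, pathObs f n pts idx s; Q] = 0 := by
  rw [h.covariance_residual t i x (h.memLp_pathObs s), h.covariance_f_pathObs]
  have hmem : ∀ r : obsTimes idx t i, idx r = i := fun r => (Finset.mem_filter.mp r.2).2
  by_cases hi : i = idx s
  · have hsA : s ∈ obsTimes idx t i := Finset.mem_filter.mpr ⟨hs, hi.symm⟩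
    have hw := congrFun (postWeight_vecMul_regGram (hK i) hρ (obsTimes idx t i) pts x) ⟨s, hsA⟩
    rw [if_pos hi]
    have hsymm : K i x (pts s) = K i (pts s) x := by
      simpa using (hK i).isHermitian.apply (pts s) x
    rw [sub_eq_zero, hsymm]
    simp only [vecMul, dotProduct] at hw
    refine hw.symm.trans (Finset.sum_congr rfl fun r _ => ?_)
    rw [h.covariance_pathObs, hmem r, if_pos hi]
    simp only [regGram, Matrix.add_apply, of_apply, Matrix.smul_apply, one_apply, smul_eq_mul, mul_ite, mul_one,
      mul_zero]
    congr 2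
    exact if_congr Subtype.ext_iff rfl rfl
  · rw [if_neg hi, zero_sub, neg_eq_zero]
    refine Finset.sum_eq_zero fun r _ => ?_
    have hrs : (r : ℕ) ≠ s := fun hrs => hi (by rw [← hrs, hmem r])
    rw [h.covariance_pathObs, hmem r, if_neg hi, if_neg hrs]
    simp

theorem memLp_residual (h : IsNoisyGP Q f n K ρ) (t : ℕ) (i : Fin N) (x : X) :
    MemLp (residual f n K ρ pts idx t i x) 2 Q := by
  rw [residual_eq]
  exact (h.memLp_f i x).sub (memLp_finsetSum _ fun s _ => (h.memLp_pathObs _).const_mul _)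

theorem integral_residual (h : IsNoisyGP Q f n K ρ) (t : ℕ) (i : Fin N) (x : X) :
    ∫ θ, residual f n K ρ pts idx t i x θ ∂Q = 0 := by
  have := (h.gaussian_n 0).isProbabilityMeasure
  have hobs : ∀ s, ∫ θ, pathObs f n pts idx s θ ∂Q = 0 := fun s => by
    have := integral_add ((h.memLp_f (idx s) (pts s)).integrable one_le_two)
      ((h.memLp_n s).integrable one_le_two)
    rw [h.integral_f, h.integral_n, add_zero] at this
    exact this
  have hint : ∀ s : obsTimes idx t i, Integrable (fun θ =>
      postWeight (K i) ρ (obsTimes idx t i) pts x s * pathObs f n pts idx s θ) Q :=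
    fun s => ((h.memLp_pathObs s).integrable one_le_two).const_mul _
  rw [residual_eq, integral_sub ((h.memLp_f i x).integrable one_le_two)
    (integrable_finsetSum _ fun s _ => hint s), integral_finsetSum _ fun s _ => hint s,
    h.integral_f]
  simp [integral_const_mul, hobs]

theorem variance_residual (h : IsNoisyGP Q f n K ρ) (hK : ∀ i, (K i).PosSemidef)
    (hρ : 0 < ρ) (t : ℕ) (i : Fin N) (x : X) :
    Var[residual f n K ρ pts idx t i x; Q] = postCov (K i) ρ (obsTimes idx t i) pts x x := by
  have hmem : ∀ r : obsTimes idx t i, idx r = i := fun r => (Finset.mem_filter.mp r.2).2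
  have hR := h.memLp_residual (pts := pts) (idx := idx) t i x
  rw [← covariance_self hR.aemeasurable, h.covariance_residual t i x hR, covariance_comm,
    Finset.sum_eq_zero fun s _ => ?_, sub_zero, h.covariance_residual t i x (h.memLp_f i x),
    h.covariance_f, postCov, dotProduct_mulVec]
  · congr 1
    refine Finset.sum_congr rfl fun r _ => ?_
    rw [covariance_comm, h.covariance_f_pathObs, hmem r, if_pos rfl]
    have hsymm : K i x (pts r) = K i (pts r) x := by
      simpa using (hK i).isHermitian.apply (pts r) x
    rw [hsymm]
    rfl
  · rw [covariance_comm, h.covariance_residual_pathObs hK hρ t i x (Finset.mem_filter.mp s.2).1,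
      mul_zero]

theorem jointly_gaussian_residual [Fintype X] (h : IsNoisyGP Q f n K ρ) (t : ℕ) (i : Fin N) (x : X) :
    HasGaussianLaw (fun θ => ((fun _ : Unit => residual f n K ρ pts idx t i x θ),
      fun s : Finset.Icc 1 t => pathObs f n pts idx s θ)) Q := by
  let E := (Fin N → X → ℝ) × (Finset.Icc 1 t → ℝ)
  let ev : Fin N → X → E →L[ℝ] ℝ := fun i x =>
    (ContinuousLinearMap.proj (R := ℝ) (φ := fun _ : X => ℝ) x).comp
      ((ContinuousLinearMap.proj (R := ℝ) (φ := fun _ : Fin N => X → ℝ) i).comp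
        (ContinuousLinearMap.fst ℝ _ _))
  let ob : Finset.Icc 1 t → E →L[ℝ] ℝ := fun s => ev (idx s) (pts s) +
    (ContinuousLinearMap.proj (R := ℝ) (φ := fun _ : Finset.Icc 1 t => ℝ) s).comp
      (ContinuousLinearMap.snd ℝ _ _)
  let re : E →L[ℝ] ℝ := ev i x - ∑ s : obsTimes idx t i,
    postWeight (K i) ρ (obsTimes idx t i) pts x s • ob ⟨s, (Finset.mem_filter.mp s.2).1⟩
  have := (h.jointly_gaussian (Finset.Icc 1 t)).map_fun
    ((ContinuousLinearMap.pi fun _ : Unit => re).prod (ContinuousLinearMap.pi ob))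
  refine this.congr (ae_of_all _ fun θ => Prod.ext (funext fun u => ?_) rfl)
  rw [residual_eq]
  simp [re, ob, ev, pathObs, mul_add]

theorem indepFun_residual [Fintype X] (h : IsNoisyGP Q f n K ρ) (hK : ∀ i, (K i).PosSemidef)
    (hρ : 0 < ρ) (t : ℕ) (i : Fin N) (x : X) :
    IndepFun (residual f n K ρ pts idx t i x)
      (fun θ (s : Finset.Icc 1 t) => pathObs f n pts idx s θ) Q := by
  have := (h.jointly_gaussian_residual (pts := pts) (idx := idx) t i x).indepFun_of_covariance_eval
    fun _ s => h.covariance_residual_pathObs hK hρ t i x s.2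
  exact this.comp (φ := fun g : Unit → ℝ => g ()) (ψ := id) (by fun_prop) measurable_id

/-- Conditionally on the observations, the residual stays below `√b` posterior standard deviations
up to probability `exp (-b / 2)`, for both signs `c = ±1`. -/
theorem measure_residual_gt_le [Fintype X] (h : IsNoisyGP Q f n K ρ) (hK : ∀ i, (K i).PosSemidef)
    (hρ : 0 < ρ) (t : ℕ) (i : Fin N) (x : X) {b c : ℝ} (hb : 0 ≤ b) (hc : c ^ 2 = 1)
    {W : Set (Finset.Icc 1 t → ℝ)} (hW : MeasurableSet W) :
    Q {θ | (fun s : Finset.Icc 1 t => pathObs f n pts idx s θ) ∈ W ∧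
      √b * postStd (K i) ρ (obsTimes idx t i) pts x <
        c * residual f n K ρ pts idx t i x θ} ≤
      ENNReal.ofReal (Real.exp (-(b / 2))) *
        Q {θ | (fun s : Finset.Icc 1 t => pathObs f n pts idx s θ) ∈ W} := by
  have hind : IndepFun (fun θ => c * residual f n K ρ pts idx t i x θ)
      (fun θ (s : Finset.Icc 1 t) => pathObs f n pts idx s θ) Q :=
    (h.indepFun_residual hK hρ t i x).comp (φ := fun z => c * z) (by fun_prop) measurable_id
  have hgauss : HasGaussianLaw (fun θ => c * residual f n K ρ pts idx t i x θ) Q :=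
    ((h.jointly_gaussian_residual (pts := pts) (idx := idx) t i x).fst.eval ()).fun_smul c
  have htail := gaussian_tail_le hgauss
    (by rw [integral_const_mul, h.integral_residual, mul_zero])
    (by rw [variance_const_mul, hc, one_mul, h.variance_residual hK hρ]) hb
  have := hind.measure_inter_preimage_eq_mul (Set.Ioi (√b * √(postCov (K i) ρ (obsTimes idx t i)
    pts x x))) W measurableSet_Ioi hW
  rw [Set.inter_comm] at this
  refine this.le.trans ?_
  exact mul_le_mul_left htail _

end IsNoisyGP

/-! ### Measurability -/

section Measurability

variable {α : Type*} [MeasurableSpace α]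

theorem measurable_det {m : Type*} [Fintype m] [DecidableEq m] {M : α → Matrix m m ℝ}
    (hM : ∀ i j, Measurable fun a => M a i j) : Measurable fun a => (M a).det := by
  simp_rw [det_apply]
  exact Finset.measurable_fun_sum _ fun σ _ =>
    (Finset.measurable_fun_prod _ fun i _ => hM _ _).const_smul _

theorem measurable_inv_apply {m : Type*} [Fintype m] [DecidableEq m] {M : α → Matrix m m ℝ}
    (hM : ∀ i j, Measurable fun a => M a i j) (i j : m) :
    Measurable fun a => (M a)⁻¹ i j := by
  simp_rw [inv_def, Ring.inverse_eq_inv', Matrix.smul_apply, adjugate_apply, smul_eq_mul]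
  refine (measurable_det hM).inv.mul (measurable_det fun k l => ?_)
  by_cases hk : k = j
  · subst hk; simp
  · simpa [updateRow_ne hk] using hM k l

variable {X : Type*} {K : α → Matrix X X ℝ}

theorem measurable_regGram_inv (hK : ∀ x x', Measurable fun a => K a x x') (ρ : ℝ) (A : Finset ℕ)
    (pts : ℕ → X) (i j : A) : Measurable fun a => (regGram (K a) ρ A pts)⁻¹ i j := by
  refine measurable_inv_apply (fun i j => ?_) i j
  simp only [regGram, Matrix.add_apply, of_apply]
  exact (hK _ _).add_const _

theorem measurable_postMean (hK : ∀ x x', Measurable fun a => K a x x') {y : α → ℕ → ℝ}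
    (ρ : ℝ) (A : Finset ℕ) (pts : ℕ → X) (hy : ∀ s ∈ A, Measurable fun a => y a s) (x : X) :
    Measurable fun a => postMean (K a) ρ A pts (y a) x := by
  simp only [postMean, dotProduct, mulVec, kernelVec]
  exact Finset.measurable_fun_sum _ fun i _ => (hK _ _).mul <|
    Finset.measurable_fun_sum _ fun j _ => (measurable_regGram_inv hK ρ A pts i j).mul (hy j j.2)

theorem measurable_postStd (hK : ∀ x x', Measurable fun a => K a x x')
    (ρ : ℝ) (A : Finset ℕ) (pts : ℕ → X) (x : X) :
    Measurable fun a => postStd (K a) ρ A pts x := by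
  simp only [postStd, postCov, dotProduct, mulVec, kernelVec]
  refine ((hK x x).sub ?_).sqrt
  exact Finset.measurable_fun_sum _ fun i _ => (hK _ _).mul <|
    Finset.measurable_fun_sum _ fun j _ => (measurable_regGram_inv hK ρ A pts i j).mul (hK _ _)

/-- A minimiser of a finite family of reals can be chosen measurably. -/
theorem exists_measurable_argmin {N : ℕ} (hN : 1 ≤ N) :
    ∃ am : (Fin N → ℝ) → Fin N, (∀ (u : Fin N → ℝ) (j : Fin N), u (am u) ≤ u j) ∧ ∀ i, MeasurableSet {u | am u = i} := by
  have : Nonempty (Fin N) := ⟨⟨0, hN⟩⟩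
  have hne : ∀ u : Fin N → ℝ, (Finset.univ.filter fun i => ∀ j, u i ≤ u j).Nonempty := fun u => by
    obtain ⟨i, hi⟩ := Finite.exists_min u
    exact ⟨i, by simpa using hi⟩
  refine ⟨fun u => (Finset.univ.filter fun i => ∀ j, u i ≤ u j).min' (hne u), fun u => ?_,
    fun i => ?_⟩
  · simpa using Finset.min'_mem _ (hne u)
  · have : {u : Fin N → ℝ | (Finset.univ.filter fun i => ∀ j, u i ≤ u j).min' (hne u) = i} =
        {u | ∀ j, u i ≤ u j} ∩ ⋂ l ∈ Finset.Iio i, {u | ∀ j, u l ≤ u j}ᶜ := by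
      ext u
      rw [Set.mem_ofPred_eq, Finset.min'_eq_iff]
      simp only [Finset.mem_filter, Finset.mem_univ, true_and, Set.mem_inter_iff, Set.mem_ofPred_eq,
        Finset.mem_Iio, Set.mem_iInter, Set.mem_compl_iff]
      refine and_congr_right fun _ => forall_congr' fun l => ?_
      rw [← not_imp_not, not_le]
    rw [this]
    have hmeas : ∀ l : Fin N, MeasurableSet {u : Fin N → ℝ | ∀ j, u l ≤ u j} := fun l => by
      rw [Set.ofPred_forall]
      exact MeasurableSet.iInter fun j =>
        measurableSet_le (measurable_pi_apply l) (measurable_pi_apply j)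
    exact (hmeas i).inter (Finset.measurableSet_biInter _ fun l _ => (hmeas l).compl)

end Measurability

/-! ### The robust Gaussian process prior -/

theorem iIndepFun_comp_measurePreserving_iff {α β ι : Type*} [MeasurableSpace α]
    [MeasurableSpace β] {E : ι → Type*} [∀ i, MeasurableSpace (E i)] {μ : Measure α}
    {ν : Measure β} {φ : α → β} (hφ : MeasurePreserving φ μ ν) {X : ∀ i, β → E i}
    (hX : ∀ i, Measurable (X i)) : iIndepFun (fun i a => X i (φ a)) μ ↔ iIndepFun X ν := by
  rw [iIndepFun_iff_measure_inter_preimage_eq_mul, iIndepFun_iff_measure_inter_preimage_eq_mul]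
  refine forall_congr' fun S => forall_congr' fun sets => forall_congr' fun hsets => ?_
  have hpre : ∀ i ∈ S, μ ((fun a => X i (φ a)) ⁻¹' sets i) = ν (X i ⁻¹' sets i) := fun i hi =>
    hφ.measure_preimage ((hX i) (hsets i hi)).nullMeasurableSet
  rw [Finset.prod_congr rfl hpre, ← hφ.measure_preimage
    (Finset.measurableSet_biInter S fun i hi => (hX i) (hsets i hi)).nullMeasurableSet]
  simp only [Set.preimage_iInter]
  rfl

namespace IsRobustGP

variable {X Δ Ω : Type*} [MeasurableSpace Δ] [MeasurableSpace Ω]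
  {F : X → Δ × Ω → ℝ} {k : Δ → Matrix X X ℝ} {κ : Kernel Δ Ω}

theorem memLp (h : IsRobustGP F k κ) (δ : Δ) (x : X) : MemLp (fun ω => F x (δ, ω)) 2 (κ δ) :=
  ((h.gaussian δ).hasGaussianLaw_eval x).memLp_two

theorem measurable_kernel [IsMarkovKernel κ] (h : IsRobustGP F k κ) (x x' : X) :
    Measurable fun δ => k δ x x' := by
  have hk : ∀ δ, k δ x x' = ∫ ω, (fun z => F x z * F x' z) (δ, ω) ∂(κ δ) := fun δ => by
    rw [← h.covariance_eq, covariance]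
    simp [h.mean_zero]
  simp_rw [hk]
  exact (StronglyMeasurable.integral_kernel_prod_right'
    ((h.measurable x).mul (h.measurable x')).stronglyMeasurable).measurable

theorem posSemidef_kernel [Fintype X] [IsMarkovKernel κ] (h : IsRobustGP F k κ) (δ : Δ) :
    (k δ).PosSemidef := by
  refine PosSemidef.of_dotProduct_mulVec_nonneg ?_ fun c => ?_
  · ext x x'
    rw [conjTranspose_apply, star_trivial, ← h.covariance_eq, ← h.covariance_eq, covariance_comm]
  · have hmem : ∀ x, MemLp (fun ω => c x * F x (δ, ω)) 2 (κ δ) := fun x =>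
      (h.memLp δ x).const_mul _
    have hvar := variance_nonneg (fun ω => ∑ x, c x * F x (δ, ω)) (κ δ)
    rw [← covariance_self (memLp_finsetSum _ fun x _ => hmem x).aemeasurable,
      covariance_fun_sum_fun_sum hmem hmem] at hvar
    simp_rw [covariance_const_mul_left, covariance_const_mul_right, h.covariance_eq] at hvar
    refine hvar.trans_eq ?_
    simp only [star_trivial, dotProduct, mulVec, Finset.mul_sum]
    exact Finset.sum_congr rfl fun x _ => Finset.sum_congr rfl fun x' _ => by ring

/-- For fixed uncertain parameters `δ i`, the functions `F · (δ i, ω i)` and the noise form a noisy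
Gaussian process. -/
theorem isNoisyGP [IsMarkovKernel κ] [Fintype X] (h : IsRobustGP F k κ) {N : ℕ} (δ : Fin N → Δ)
    {ν : Measure (ℕ → ℝ)} [IsProbabilityMeasure ν] {ρ : ℝ}
    (hν : ∀ t, ν.map (fun n => n t) = gaussianReal 0 (ρ ^ 2).toNNReal)
    (hνi : iIndepFun (fun t (n : ℕ → ℝ) => n t) ν) :
    IsNoisyGP ((Measure.pi fun i => κ (δ i)).prod ν)
      (fun i x (θ : (Fin N → Ω) × (ℕ → ℝ)) => F x (δ i, θ.1 i)) (fun t θ => θ.2 t)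
      (fun i => k (δ i)) ρ := by
  have hFm : ∀ i x, Measurable fun ω => F x (δ i, ω) := fun i x =>
    (h.measurable x).comp measurable_prodMk_left
  have hFm' : ∀ i, Measurable fun ω x => F x (δ i, ω) := fun i => measurable_pi_lambda _ (hFm i)
  have hF : ∀ i, MeasurePreserving (fun θ : (Fin N → Ω) × (ℕ → ℝ) => θ.1 i)
      ((Measure.pi fun i => κ (δ i)).prod ν) (κ (δ i)) := fun i =>
    (measurePreserving_eval (fun i => κ (δ i)) i).comp measurePreserving_fst
  have hn : MeasurePreserving (fun θ : (Fin N → Ω) × (ℕ → ℝ) => θ.2)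
      ((Measure.pi fun i => κ (δ i)).prod ν) ν := measurePreserving_snd
  refine ⟨fun i => ?_, ?_, fun i x => ?_, fun i x x' => ?_, fun t => ?_, fun t => ?_, ?_, ?_⟩
  · have hg : HasGaussianLaw (fun ω x => F x (δ i, ω)) (κ (δ i)) := by
      have := ((h.gaussian (δ i)).hasGaussianLaw Finset.univ).map_fun
        (ContinuousLinearMap.pi fun x : X =>
          ContinuousLinearMap.proj (R := ℝ) (φ := fun _ : (Finset.univ : Finset X) => ℝ)
            ⟨x, Finset.mem_univ x⟩)
      exact this
    refine ⟨?_⟩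
    have hcomp : (fun (θ : (Fin N → Ω) × (ℕ → ℝ)) x => F x (δ i, θ.1 i)) =
        (fun ω x => F x (δ i, ω)) ∘ fun θ => θ.1 i := rfl
    rw [hcomp, ← Measure.map_map (hFm' i) (by fun_prop), (hF i).map_eq]
    exact hg.isGaussian_map
  · exact (iIndepFun_comp_measurePreserving_iff measurePreserving_fst
      (X := fun i (ω : Fin N → Ω) x => F x (δ i, ω i))
      (fun i => (hFm' i).comp (measurable_pi_apply i))).mpr
      (iIndepFun_pi (μ := fun i => κ (δ i)) (X := fun i ω x => F x (δ i, ω))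
        fun i => (hFm' i).aemeasurable)
  · have := integral_map (μ := (Measure.pi fun i => κ (δ i)).prod ν) (hF i).aemeasurable
      (f := fun ω => F x (δ i, ω)) (hFm i x).aestronglyMeasurable
    rw [(hF i).map_eq, h.mean_zero] at this
    exact this.symm
  · have := covariance_map_fun (μ := (Measure.pi fun i => κ (δ i)).prod ν)
      (X := fun ω => F x (δ i, ω)) (Y := fun ω => F x' (δ i, ω))
      (hFm i x).aestronglyMeasurable (hFm i x').aestronglyMeasurable (hF i).aemeasurable
    rw [(hF i).map_eq, h.covariance_eq] at this
    exact this.symm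
  · have := Measure.map_map (μ := (Measure.pi fun i => κ (δ i)).prod ν)
      (g := fun n : ℕ → ℝ => n t) (measurable_pi_apply t) hn.measurable
    rw [hn.map_eq, hν t] at this
    exact this.symm
  · fun_prop
  · exact (iIndepFun_comp_measurePreserving_iff hn measurable_pi_apply).mpr hνi
  · exact indepFun_prod (X := fun (ω : Fin N → Ω) i x => F x (δ i, ω i)) (Y := fun n : ℕ → ℝ => n)
      (measurable_pi_lambda _ fun i => (hFm' i).comp (measurable_pi_apply i)) measurable_id

end IsRobustGP

/-! ### Conditioning on the uncertain parameters -/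

section Disintegration

variable {Δ Ω : Type*} [MeasurableSpace Δ] [MeasurableSpace Ω]

/-- The conditional law of `(ω_1, …, ω_N)` given `(δ_1, …, δ_N)`. -/
noncomputable def piKernel (κ : Kernel Δ Ω) [IsMarkovKernel κ] (N : ℕ) :
    Kernel (Fin N → Δ) (Fin N → Ω) where
  toFun δ := Measure.pi fun i => κ (δ i)
  measurable' := by
    refine Measurable.measure_of_isPiSystem_of_isProbabilityMeasure generateFrom_pi.symm
      isPiSystem_pi ?_
    rintro _ ⟨s, hs, rfl⟩
    simp_rw [Measure.pi_pi]
    exact Finset.measurable_fun_prod _ fun i _ =>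
      (κ.measurable_coe (hs i (Set.mem_univ i))).comp (measurable_pi_apply i)

instance (κ : Kernel Δ Ω) [IsMarkovKernel κ] (N : ℕ) : IsMarkovKernel (piKernel κ N) :=
  ⟨fun δ => by change IsProbabilityMeasure (Measure.pi fun i => κ (δ i)); infer_instance⟩

theorem map_pi_compProd (Pδ : Measure Δ) [IsProbabilityMeasure Pδ] (κ : Kernel Δ Ω)
    [IsMarkovKernel κ] (N : ℕ) :
    (Measure.pi fun _ : Fin N => Pδ ⊗ₘ κ).map (fun z => (fun i => (z i).1, fun i => (z i).2)) =
      (Measure.pi fun _ : Fin N => Pδ) ⊗ₘ piKernel κ N := by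
  have hm : Measurable fun (z : Fin N → Δ × Ω) => (fun i => (z i).1, fun i => (z i).2) := by
    fun_prop
  have hm' : Measurable fun (z : (Fin N → Δ) × (Fin N → Ω)) (i : Fin N) => (z.1 i, z.2 i) := by
    fun_prop
  have key : ((Measure.pi fun _ : Fin N => Pδ) ⊗ₘ piKernel κ N).map
      (fun z i => (z.1 i, z.2 i)) = Measure.pi fun _ : Fin N => Pδ ⊗ₘ κ := by
    symm
    refine Measure.pi_eq fun s hs => ?_
    rw [Measure.map_apply hm' (MeasurableSet.univ_pi hs),
      Measure.compProd_apply (hm' (MeasurableSet.univ_pi hs))]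
    have hpre : ∀ δ : Fin N → Δ, piKernel κ N δ (Prod.mk δ ⁻¹'
        ((fun z : (Fin N → Δ) × (Fin N → Ω) => fun i => (z.1 i, z.2 i)) ⁻¹' Set.univ.pi s)) =
        ∏ i, κ (δ i) (Prod.mk (δ i) ⁻¹' s i) := fun δ => by
      rw [← Measure.pi_pi]
      change Measure.pi _ _ = _
      congr 1
    simp_rw [hpre]
    have hind : iIndepFun (fun i (δ : Fin N → Δ) => κ (δ i) (Prod.mk (δ i) ⁻¹' s i))
        (Measure.pi fun _ : Fin N => Pδ) :=
      iIndepFun_pi (X := fun i δ => κ δ (Prod.mk δ ⁻¹' s i))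
        fun i => (Kernel.measurable_kernel_prodMk_left (hs i)).aemeasurable
    rw [lintegral_prod_eq_prod_lintegral_of_indepFun Finset.univ _ hind fun i =>
      (Kernel.measurable_kernel_prodMk_left (hs i)).comp (measurable_pi_apply i)]
    refine Finset.prod_congr rfl fun i _ => ?_
    rw [Measure.compProd_apply (hs i)]
    exact (measurePreserving_eval (fun _ : Fin N => Pδ) i).lintegral_comp
      (Kernel.measurable_kernel_prodMk_left (hs i))
  rw [← key, Measure.map_map hm hm']
  exact Measure.map_id

theorem IsScenarioSample.measurable_noise_pi {S : Type*} [MeasurableSpace S] {P : Measure S}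
    {Pδ : Measure Δ} {κ : Kernel Δ Ω} {ρ : ℝ} {N : ℕ} {d : Fin N → S → Δ × Ω} {noise : ℕ → S → ℝ}
    (h : IsScenarioSample P Pδ κ ρ d noise) : Measurable fun s t => noise t s :=
  measurable_pi_lambda _ h.measurable_noise

variable {S : Type*} [MeasurableSpace S] {P : Measure S} [IsProbabilityMeasure P]
  {Pδ : Measure Δ} [IsProbabilityMeasure Pδ] {κ : Kernel Δ Ω} [IsMarkovKernel κ] {ρ : ℝ} {N : ℕ}
  {d : Fin N → S → Δ × Ω} {noise : ℕ → S → ℝ}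

namespace IsScenarioSample

/-- Disintegration: given `(δ_1, …, δ_N)`, the `ω_i` are independent with laws `κ (δ_i)` and
independent of the noise. -/
theorem measure_eq_lintegral (h : IsScenarioSample P Pδ κ ρ d noise)
    {E : Set ((Fin N → Δ) × ((Fin N → Ω) × (ℕ → ℝ)))} (hE : MeasurableSet E) :
    P {s | (fun i => (d i s).1, (fun i => (d i s).2, fun t => noise t s)) ∈ E} =
      ∫⁻ δ, ((Measure.pi fun i => κ (δ i)).prod (P.map fun s t => noise t s))
        (Prod.mk δ ⁻¹' E) ∂(Measure.pi fun _ : Fin N => Pδ) := by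
  have hd : Measurable fun s i => d i s := measurable_pi_lambda _ h.measurable_d
  have hn := h.measurable_noise_pi
  have : IsProbabilityMeasure (P.map fun s t => noise t s) :=
    Measure.isProbabilityMeasure_map hn.aemeasurable
  have hlaw : P.map (fun s i => d i s) = Measure.pi fun _ : Fin N => Pδ ⊗ₘ κ := by
    rw [(iIndepFun_iff_map_fun_eq_pi_map fun i => (h.measurable_d i).aemeasurable).mp h.indep_d]
    simp_rw [h.law_d]
  have hjoint := (indepFun_iff_map_prod_eq_prod_map_map hd.aemeasurable hn.aemeasurable).mp h.indep
  have hre : Measurable fun (z : (Fin N → Δ × Ω) × (ℕ → ℝ)) =>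
      (fun i => (z.1 i).1, (fun i => (z.1 i).2, z.2)) := by fun_prop
  have hassoc : Measurable fun (z : ((Fin N → Δ) × (Fin N → Ω)) × (ℕ → ℝ)) =>
      (z.1.1, (z.1.2, z.2)) := by fun_prop
  have hmeas : Measurable fun z : (Fin N → Δ) × (Fin N → Ω) =>
      (P.map fun s t => noise t s) {n | (z.1, (z.2, n)) ∈ E} :=
    measurable_measure_prodMk_left (hassoc hE)
  calc P {s | (fun i => (d i s).1, (fun i => (d i s).2, fun t => noise t s)) ∈ E}
      = (P.map fun s => ((fun i => d i s), fun t => noise t s))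
          ((fun z : (Fin N → Δ × Ω) × (ℕ → ℝ) =>
            (fun i => (z.1 i).1, (fun i => (z.1 i).2, z.2))) ⁻¹' E) := by
        rw [Measure.map_apply (hd.prodMk hn) (hre hE)]; rfl
    _ = ∫⁻ z, (P.map fun s t => noise t s) {n | (z.1, (z.2, n)) ∈ E}
          ∂((Measure.pi fun _ : Fin N => Pδ) ⊗ₘ piKernel κ N) := by
        rw [hjoint, hlaw, Measure.prod_apply (hre hE), ← map_pi_compProd,
          lintegral_map hmeas (by fun_prop)]
        rfl
    _ = _ := by
        rw [Measure.lintegral_compProd hmeas]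
        refine lintegral_congr fun δ => ?_
        rw [Measure.prod_apply (measurable_prodMk_left hE)]
        rfl

end IsScenarioSample

end Disintegration

/-! ### Adaptive queries -/

/-- The sequence `η` with all entries outside `1, …, m` replaced by `0`. -/
def trunc (m : ℕ) (η : ℕ → ℝ) : ℕ → ℝ := fun r => if r ∈ Finset.Icc 1 m then η r else 0

theorem measurable_trunc (m : ℕ) : Measurable (trunc m) := by
  refine measurable_pi_lambda _ fun r => ?_
  unfold trunc
  split_ifs <;> fun_prop

theorem trunc_congr {m : ℕ} {η η' : ℕ → ℝ} (h : ∀ r ∈ Finset.Icc 1 m, η r = η' r) :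
    trunc m η = trunc m η' := by
  ext r
  unfold trunc
  split_ifs with hr
  · exact h r hr
  · rfl

theorem trunc_trunc {l m : ℕ} (hlm : l ≤ m) (η : ℕ → ℝ) : trunc l (trunc m η) = trunc l η :=
  trunc_congr fun _ hr => if_pos (Finset.mem_Icc.mpr
    ⟨(Finset.mem_Icc.mp hr).1, (Finset.mem_Icc.mp hr).2.trans hlm⟩)

section Congruence

variable {X : Type*} {N : ℕ} {pts pts' : ℕ → X} {idx idx' : ℕ → Fin N} {y y' : ℕ → ℝ}

theorem obsTimes_congr {m : ℕ} (h : ∀ r ∈ Finset.Icc 1 m, idx r = idx' r) (i : Fin N) :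
    obsTimes idx m i = obsTimes idx' m i :=
  Finset.filter_congr fun r hr => by rw [h r hr]

theorem postMean_congr (K : Matrix X X ℝ) (ρ : ℝ) {A : Finset ℕ}
    (h : ∀ r ∈ A, pts r = pts' r) (hy : ∀ r ∈ A, y r = y' r) (x : X) :
    postMean K ρ A pts y x = postMean K ρ A pts' y' x := by
  have h1 : (fun s : A => pts s) = fun s : A => pts' s := funext fun s => h s s.2
  have h2 : (fun s : A => y s) = fun s : A => y' s := funext fun s => hy s s.2
  have h3 : kernelVec K A pts x = kernelVec K A pts' x := funext fun s => by
    simp only [kernelVec, h s s.2]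
  rw [postMean, postMean, regGram_eq, regGram_eq, h1, h2, h3]

theorem postStd_congr (K : Matrix X X ℝ) (ρ : ℝ) {A : Finset ℕ}
    (h : ∀ r ∈ A, pts r = pts' r) (x : X) : postStd K ρ A pts x = postStd K ρ A pts' x := by
  have h1 : (fun s : A => pts s) = fun s : A => pts' s := funext fun s => h s s.2
  have h3 : kernelVec K A pts x = kernelVec K A pts' x := funext fun s => by
    simp only [kernelVec, h s s.2]
  rw [postStd, postStd, postCov, postCov, regGram_eq, regGram_eq, h1, h3]

end Congruence

section Path

variable {X Δ Ω S : Type*} [Fintype X] [MeasurableSpace Δ] [MeasurableSpace Ω]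
  [MeasurableSpace S] {P : Measure S} [IsProbabilityMeasure P]
  {Pδ : Measure Δ} [IsProbabilityMeasure Pδ] {κ : Kernel Δ Ω} [IsMarkovKernel κ]
  {F : X → Δ × Ω → ℝ} {k : Δ → Matrix X X ℝ} {ρ : ℝ} {N : ℕ}
  {d : Fin N → S → Δ × Ω} {noise : ℕ → S → ℝ}

/-- The one-sided confidence bound for queries along a fixed sequence, jointly with any event that
depends on the uncertain parameters and on the first `m` observations. -/
theorem measure_path_residual_gt_le (hF : IsRobustGP F k κ)
    (hd : IsScenarioSample P Pδ κ ρ d noise) (hρ : 0 < ρ) (pts : ℕ → X) (idx : ℕ → Fin N)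
    (m : ℕ) (i : Fin N) (x : X) {b c : ℝ} (hb : 0 ≤ b) (hc : c ^ 2 = 1)
    {W : Set ((Fin N → Δ) × (ℕ → ℝ))} (hW : MeasurableSet W) :
    P {s | (fun i => (d i s).1, trunc m fun r =>
          pathObs (fun i x s => F x (d i s)) noise pts idx r s) ∈ W ∧
        √b * postStd (k (d i s).1) ρ (obsTimes idx m i) pts x <
          c * residual (fun i x s => F x (d i s)) noise (fun i => k (d i s).1) ρ pts idx m i x s} ≤
      ENNReal.ofReal (Real.exp (-(b / 2))) *
        P {s | (fun i => (d i s).1, trunc m fun r =>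
          pathObs (fun i x s => F x (d i s)) noise pts idx r s) ∈ W} := by
  have hn := hd.measurable_noise_pi
  have : IsProbabilityMeasure (P.map fun s t => noise t s) :=
    Measure.isProbabilityMeasure_map hn.aemeasurable
  -- The process as a function of `δ`, `ω` and the noise.
  let f : (Fin N → Δ) → Fin N → X → (Fin N → Ω) × (ℕ → ℝ) → ℝ := fun δ i x θ => F x (δ i, θ.1 i)
  let n : ℕ → (Fin N → Ω) × (ℕ → ℝ) → ℝ := fun t θ => θ.2 t
  let E₁ : Set ((Fin N → Δ) × ((Fin N → Ω) × (ℕ → ℝ))) :=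
    {z | (z.1, trunc m fun r => pathObs (f z.1) n pts idx r z.2) ∈ W}
  let E₂ : Set ((Fin N → Δ) × ((Fin N → Ω) × (ℕ → ℝ))) :=
    {z | √b * postStd (k (z.1 i)) ρ (obsTimes idx m i) pts x <
      c * residual (f z.1) n (fun i => k (z.1 i)) ρ pts idx m i x z.2}
  have hfm : ∀ i x, Measurable fun z : (Fin N → Δ) × ((Fin N → Ω) × (ℕ → ℝ)) => f z.1 i x z.2 :=
    fun i x => (hF.measurable x).comp (by fun_prop)
  have hobs : ∀ r, Measurable fun z : (Fin N → Δ) × ((Fin N → Ω) × (ℕ → ℝ)) =>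
      pathObs (f z.1) n pts idx r z.2 := fun r => (hfm _ _).add (by fun_prop)
  have hkm : ∀ x x', Measurable fun z : (Fin N → Δ) × ((Fin N → Ω) × (ℕ → ℝ)) =>
      k (z.1 i) x x' := fun x x' => (hF.measurable_kernel x x').comp (by fun_prop)
  have hE₁ : MeasurableSet E₁ :=
    (measurable_fst.prodMk ((measurable_trunc m).comp (measurable_pi_lambda _ hobs))) hW
  have hE₂ : MeasurableSet E₂ := by
    refine measurableSet_lt ((measurable_postStd hkm ρ _ pts x).const_mul _) ?_
    exact ((hfm i x).sub (measurable_postMean hkm ρ _ pts (fun s _ => hobs s) x)).const_mul _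
  have h1 := hd.measure_eq_lintegral (hE₁.inter hE₂)
  have h2 := hd.measure_eq_lintegral hE₁
  refine h1.trans_le (le_of_le_of_eq ?_ (congrArg _ h2.symm))
  rw [← lintegral_const_mul' _ _ ENNReal.ofReal_ne_top]
  refine lintegral_mono fun δ => ?_
  have hgp : IsNoisyGP ((Measure.pi fun i => κ (δ i)).prod (P.map fun s t => noise t s))
      (f δ) n (fun i => k (δ i)) ρ := by
    refine hF.isNoisyGP δ (fun t => ?_) ?_
    · rw [Measure.map_map (measurable_pi_apply t) hn, Real.toNNReal_of_nonneg (sq_nonneg ρ)]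
      exact hd.law_noise t
    · exact (iIndepFun_comp_measurePreserving_iff (hn.measurePreserving P)
        measurable_pi_apply).mp hd.indep_noise
  let e : (Finset.Icc 1 m → ℝ) → (Fin N → Δ) × (ℕ → ℝ) := fun η =>
    (δ, fun r => if hr : r ∈ Finset.Icc 1 m then η ⟨r, hr⟩ else 0)
  have he : Measurable e := by
    refine measurable_const.prodMk (measurable_pi_lambda _ fun r => ?_)
    split_ifs <;> fun_prop
  exact hgp.measure_residual_gt_le (fun i => hF.posSemidef_kernel (δ i)) hρ m i x hb hc (he hW)

end Path

section Adaptive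

variable {X Δ Ω S : Type*} [Fintype X] [MeasurableSpace Δ] {N : ℕ}
  {F : X → Δ × Ω → ℝ} {k : Δ → Matrix X X ℝ} {ρ ε : ℝ}
  {d : Fin N → S → Δ × Ω} {noise : ℕ → S → ℝ}
  {x : ℕ → S → X} {idx : ℕ → S → Fin N} {y : ℕ → S → ℝ}

theorem history_mono (d : Fin N → S → Δ × Ω) (y : ℕ → S → ℝ) {l m : ℕ} (h : l ≤ m) :
    history d y l ≤ history d y m :=
  sup_le_sup le_rfl <| biSup_mono fun _ hr => Finset.Ico_subset_Ico_right h hr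

theorem measurable_history_fst (d : Fin N → S → Δ × Ω) (y : ℕ → S → ℝ) (m : ℕ) :
    Measurable[history d y m] fun s i => (d i s).1 :=
  (comap_measurable _).mono le_sup_left le_rfl

theorem measurable_history_obs (d : Fin N → S → Δ × Ω) (y : ℕ → S → ℝ) {m r : ℕ}
    (hr : r ∈ Finset.Icc 1 m) : Measurable[history d y (m + 1)] (y r) :=
  (comap_measurable (y r)).mono ((le_biSup (fun r => MeasurableSpace.comap (y r) (borel ℝ))
    (show r ∈ Finset.Ico 1 (m + 1) by
      rw [Finset.mem_Icc] at hr; rw [Finset.mem_Ico]; omega)).trans le_sup_right) le_rfl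

/-- An event known before round `m + 1` is a measurable condition on the uncertain parameters and
the first `m` observations. -/
theorem exists_preimage_of_measurableSet_history {m : ℕ} {A : Set S}
    (hA : MeasurableSet[history d y (m + 1)] A) :
    ∃ V : Set ((Fin N → Δ) × (ℕ → ℝ)), MeasurableSet V ∧
      ∀ s, s ∈ A ↔ (fun i => (d i s).1, trunc m fun r => y r s) ∈ V := by
  let H : S → (Fin N → Δ) × (ℕ → ℝ) := fun s => (fun i => (d i s).1, trunc m fun r => y r s)
  have hle : history d y (m + 1) ≤ MeasurableSpace.comap H inferInstance := by
    refine sup_le ?_ (iSup₂_le fun r hr => ?_)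
    · exact (measurable_fst.comp (comap_measurable H)).comap_le
    · have : y r = (fun z : (Fin N → Δ) × (ℕ → ℝ) => z.2 r) ∘ H := by
        ext s
        have hr' : r ∈ Finset.Icc 1 m := by
          rw [Finset.mem_Ico] at hr; rw [Finset.mem_Icc]; omega
        simp only [Function.comp_apply, H, trunc, if_pos hr']
      rw [this]
      exact (((measurable_pi_apply r).comp measurable_snd).comp (comap_measurable H)).comap_le
  obtain ⟨V, hV, hVA⟩ := hle A hA
  exact ⟨V, hV, fun s => by rw [← hVA]; rfl⟩

namespace IsScenarioUCBRun

theorem measurableSet_query_eq (h : IsScenarioUCBRun F k ρ ε d noise x idx y) {t : ℕ}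
    (ht : 1 ≤ t) (q : X × Fin N) :
    MeasurableSet[history d y t] {s | (x t s, idx t s) = q} := by
  have h1 : MeasurableSet[history d y t] (x t ⁻¹' {q.1}) := h.adapted_x t ht trivial
  have h2 : MeasurableSet[history d y t] (idx t ⁻¹' {q.2}) := h.adapted_idx t ht trivial
  convert h1.inter h2 using 1
  ext s
  simp [Prod.ext_iff]

theorem obs_eq_pathObs (h : IsScenarioUCBRun F k ρ ε d noise x idx y) {t : ℕ} (ht : 1 ≤ t)
    {p : ℕ → X × Fin N} {s : S} (hp : (x t s, idx t s) = p t) :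
    y t s = pathObs (fun i x s => F x (d i s)) noise (fun r => (p r).1) (fun r => (p r).2) t s := by
  rw [h.observe t ht s, pathObs, ← hp]

/-- Whether the run follows a fixed path of queries up to round `m` can be read off from the
observations that the fixed path would have produced. -/
theorem exists_path_event (h : IsScenarioUCBRun F k ρ ε d noise x idx y) (m : ℕ)
    (p : ℕ → X × Fin N) :
    ∃ U : Set ((Fin N → Δ) × (ℕ → ℝ)), MeasurableSet U ∧
      ∀ s, (∀ r ∈ Finset.Icc 1 m, (x r s, idx r s) = p r) ↔
        (fun i => (d i s).1, trunc m fun r => pathObs (fun i x s => F x (d i s)) noise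
          (fun r => (p r).1) (fun r => (p r).2) r s) ∈ U := by
  choose V hVm hV using fun l => exists_preimage_of_measurableSet_history
    (h.measurableSet_query_eq (Nat.le_add_left 1 l) (p (l + 1)))
  refine ⟨⋂ l ∈ Finset.range m, (fun z => (z.1, trunc l z.2)) ⁻¹' V l,
    Finset.measurableSet_biInter _ fun l _ =>
      (measurable_fst.prodMk ((measurable_trunc l).comp measurable_snd)) (hVm l), fun s => ?_⟩
  simp only [Set.mem_iInter, Set.mem_preimage, Finset.mem_range]
  have hstep : ∀ l, l < m → (∀ r ∈ Finset.Icc 1 l, (x r s, idx r s) = p r) →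
      ((x (l + 1) s, idx (l + 1) s) = p (l + 1) ↔
        (fun i => (d i s).1, trunc l (trunc m fun r => pathObs (fun i x s => F x (d i s)) noise
          (fun r => (p r).1) (fun r => (p r).2) r s)) ∈ V l) := fun l hl hr => by
    rw [trunc_trunc hl.le, ← trunc_congr fun r hr' =>
      h.obs_eq_pathObs (Finset.mem_Icc.mp hr').1 (hr r hr')]
    exact hV l s
  constructor
  · intro hp l hl
    refine (hstep l hl fun r hr => hp r ?_).mp (hp (l + 1) ?_)
    · rw [Finset.mem_Icc] at hr ⊢; omega
    · rw [Finset.mem_Icc]; omega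
  · intro hU
    have : ∀ l ≤ m, ∀ r ∈ Finset.Icc 1 l, (x r s, idx r s) = p r := fun l => by
      induction l with
      | zero => intro _ r hr; simp at hr
      | succ l ih =>
        intro hl r hr
        rcases (Finset.mem_Icc.mp hr).2.eq_or_lt with rfl | hlt
        · exact (hstep l hl (ih (by omega))).mpr (hU l hl)
        · exact ih (by omega) r (Finset.mem_Icc.mpr ⟨(Finset.mem_Icc.mp hr).1, by omega⟩)
    exact this m le_rfl

theorem exists_preimage_pathObs (h : IsScenarioUCBRun F k ρ ε d noise x idx y) {m : ℕ}
    {p : ℕ → X × Fin N} {A : Set S} (hA : MeasurableSet[history d y (m + 1)] A)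
    (hAp : ∀ s ∈ A, ∀ r ∈ Finset.Icc 1 m, (x r s, idx r s) = p r) :
    ∃ W : Set ((Fin N → Δ) × (ℕ → ℝ)), MeasurableSet W ∧
      ∀ s, s ∈ A ↔ (fun i => (d i s).1, trunc m fun r => pathObs (fun i x s => F x (d i s)) noise
          (fun r => (p r).1) (fun r => (p r).2) r s) ∈ W := by
  obtain ⟨U, hUm, hU⟩ := h.exists_path_event m p
  obtain ⟨V, hVm, hV⟩ := exists_preimage_of_measurableSet_history hA
  refine ⟨U ∩ V, hUm.inter hVm, fun s => ?_⟩
  have hobs : (∀ r ∈ Finset.Icc 1 m, (x r s, idx r s) = p r) →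
      trunc m (fun r => y r s) = trunc m fun r => pathObs (fun i x s => F x (d i s)) noise
          (fun r => (p r).1) (fun r => (p r).2) r s := fun hp =>
    trunc_congr fun r hr => h.obs_eq_pathObs (Finset.mem_Icc.mp hr).1 (hp r hr)
  constructor
  · intro hs
    refine ⟨(hU s).mp (hAp s hs), ?_⟩
    rw [← hobs (hAp s hs)]
    exact (hV s).mp hs
  · rintro ⟨h1, h2⟩
    rw [← hobs ((hU s).mpr h1)] at h2
    exact (hV s).mpr h2

end IsScenarioUCBRun

/-- The event that `c (F(x, d_i) - μ^i_m(x))` exceeds `√b σ^i_m(x)`, for the posterior after `m`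
rounds; `c = 1` and `c = -1` give the two sides of the confidence band. -/
def exceeds (F : X → Δ × Ω → ℝ) (k : Δ → Matrix X X ℝ) (ρ : ℝ) (d : Fin N → S → Δ × Ω)
    (x : ℕ → S → X) (idx : ℕ → S → Fin N) (y : ℕ → S → ℝ) (m : ℕ) (b c : ℝ) (q : X × Fin N) :
    Set S :=
  {s | √b * postStd (k (d q.2 s).1) ρ (obsTimes (idx · s) m q.2) (x · s) q.1 <
    c * (F q.1 (d q.2 s) -
      postMean (k (d q.2 s).1) ρ (obsTimes (idx · s) m q.2) (x · s) (y · s) q.1)}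

variable [MeasurableSpace Ω] [MeasurableSpace S] {P : Measure S} [IsProbabilityMeasure P]
  {Pδ : Measure Δ} [IsProbabilityMeasure Pδ] {κ : Kernel Δ Ω} [IsMarkovKernel κ]

namespace IsScenarioUCBRun

theorem measurableSet_of_path (h : IsScenarioUCBRun F k ρ ε d noise x idx y)
    (hF : ∀ x, Measurable (F x)) (hd : ∀ i, Measurable (d i)) (hn : ∀ t, Measurable (noise t))
    {m : ℕ} {p : ℕ → X × Fin N} {A : Set S} (hA : MeasurableSet[history d y (m + 1)] A)
    (hAp : ∀ s ∈ A, ∀ r ∈ Finset.Icc 1 m, (x r s, idx r s) = p r) : MeasurableSet A := by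
  obtain ⟨W, hWm, hW⟩ := h.exists_preimage_pathObs hA hAp
  have hmeas : Measurable fun s => ((fun i => (d i s).1 : Fin N → Δ), trunc m fun r =>
      pathObs (fun i x s => F x (d i s)) noise (fun r => (p r).1) (fun r => (p r).2) r s) := by
    refine (measurable_pi_lambda _ fun i => (hd i).fst).prodMk
      ((measurable_trunc m).comp (measurable_pi_lambda _ fun r => ?_))
    exact ((hF _).comp (hd _)).add (hn r)
  have : A = _ := Set.ext hW
  rw [this]
  exact hmeas hWm

theorem measure_path_inter_exceeds_le (h : IsScenarioUCBRun F k ρ ε d noise x idx y)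
    (hF : IsRobustGP F k κ) (hd : IsScenarioSample P Pδ κ ρ d noise) (hρ : 0 < ρ)
    {m : ℕ} {p : ℕ → X × Fin N} {A : Set S} (hA : MeasurableSet[history d y (m + 1)] A)
    (hAp : ∀ s ∈ A, ∀ r ∈ Finset.Icc 1 m, (x r s, idx r s) = p r)
    {b c : ℝ} (hb : 0 ≤ b) (hc : c ^ 2 = 1) (q : X × Fin N) :
    P (A ∩ exceeds F k ρ d x idx y m b c q) ≤ ENNReal.ofReal (Real.exp (-(b / 2))) * P A := by
  obtain ⟨W, hWm, hW⟩ := h.exists_preimage_pathObs hA hAp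
  have key := measure_path_residual_gt_le hF hd hρ (fun r => (p r).1) (fun r => (p r).2) m q.2 q.1
    hb hc hWm
  have hAW : A = {s | (fun i => (d i s).1, trunc m fun r => pathObs (fun i x s => F x (d i s))
      noise (fun r => (p r).1) (fun r => (p r).2) r s) ∈ W} := Set.ext hW
  rw [← hAW] at key
  refine (measure_mono fun s hs => ?_).trans key
  obtain ⟨hsA, hs⟩ := hs
  have hp := hAp s hsA
  have hidx : ∀ r ∈ Finset.Icc 1 m, idx r s = (p r).2 := fun r hr => by rw [← hp r hr]
  have hobs : obsTimes (idx · s) m q.2 = obsTimes (fun r => (p r).2) m q.2 :=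
    obsTimes_congr hidx q.2
  have hpts : ∀ r ∈ obsTimes (fun r => (p r).2) m q.2, x r s = (p r).1 := fun r hr => by
    rw [← hp r (Finset.mem_filter.mp hr).1]
  refine ⟨(hW s).mp hsA, ?_⟩
  rw [exceeds, Set.mem_ofPred_eq, hobs, postStd_congr _ _ hpts, postMean_congr _ _ hpts
    fun r hr => h.obs_eq_pathObs (Finset.mem_Icc.mp (Finset.mem_filter.mp hr).1).1
      (hp r (Finset.mem_filter.mp hr).1)] at hs
  exact hs

/-- The confidence bound at a scenario and a point that are chosen from the past observations. -/
theorem measure_exceeds_le (h : IsScenarioUCBRun F k ρ ε d noise x idx y)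
    (hF : IsRobustGP F k κ) (hd : IsScenarioSample P Pδ κ ρ d noise) (hρ : 0 < ρ)
    (m : ℕ) {sel : S → X × Fin N}
    (hsel : ∀ q, MeasurableSet[history d y (m + 1)] {s | sel s = q})
    {B : Set (Fin N → Δ)} (hB : MeasurableSet B) {b c : ℝ} (hb : 0 ≤ b) (hc : c ^ 2 = 1) :
    P {s | (fun i => (d i s).1) ∈ B ∧ s ∈ exceeds F k ρ d x idx y m b c (sel s)} ≤
      ENNReal.ofReal (Real.exp (-(b / 2))) * P {s | (fun i => (d i s).1) ∈ B} := by
  classical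
  -- Decompose according to the finitely many values of the first `m` queries and of `sel`.
  let path : S → Finset.Icc 1 m → X × Fin N := fun s r => (x r s, idx r s)
  let A : (Finset.Icc 1 m → X × Fin N) × (X × Fin N) → Set S := fun z =>
    {s | path s = z.1} ∩ {s | sel s = z.2} ∩ {s | (fun i => (d i s).1) ∈ B}
  have hA : ∀ z, MeasurableSet[history d y (m + 1)] (A z) := fun z => by
    have h1 : {s | path s = z.1} = ⋂ r : Finset.Icc 1 m, {s | (x r s, idx r s) = z.1 r} := by
      ext s
      simp [path, funext_iff]
    refine MeasurableSet.inter (MeasurableSet.inter ?_ (hsel z.2))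
      (measurable_history_fst d y (m + 1) hB)
    rw [h1]
    refine MeasurableSet.iInter fun r => ?_
    have hr := Finset.mem_Icc.mp r.2
    exact history_mono d y (by omega) _ (h.measurableSet_query_eq hr.1 (z.1 r))
  have hAp : ∀ z, ∀ s ∈ A z, ∀ r ∈ Finset.Icc 1 m, (x r s, idx r s) =
      if hr : r ∈ Finset.Icc 1 m then z.1 ⟨r, hr⟩ else z.2 := fun z s hs r hr => by
    rw [dif_pos hr, ← hs.1.1]
  have hAm : ∀ z, MeasurableSet (A z) := fun z =>
    h.measurableSet_of_path hF.measurable hd.measurable_d hd.measurable_noise (hA z)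
      (hAp z)
  have hunion : {s | (fun i => (d i s).1) ∈ B} = ⋃ z, A z := by
    ext s
    simp [A]
  have hdisj : Pairwise (Function.onFun Disjoint A) := fun z z' hzz =>
    Set.disjoint_left.mpr fun s hs hs' =>
      hzz (Prod.ext (hs.1.1.symm.trans hs'.1.1) (hs.1.2.symm.trans hs'.1.2))
  calc P {s | (fun i => (d i s).1) ∈ B ∧ s ∈ exceeds F k ρ d x idx y m b c (sel s)}
      ≤ P (⋃ z, A z ∩ exceeds F k ρ d x idx y m b c z.2) := by
        refine measure_mono fun s hs => Set.mem_iUnion.mpr ⟨(path s, sel s), ⟨⟨rfl, rfl⟩, hs.1⟩, ?_⟩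
        exact hs.2
    _ ≤ ∑ z, P (A z ∩ exceeds F k ρ d x idx y m b c z.2) := measure_iUnion_fintype_le _ _
    _ ≤ ∑ z, ENNReal.ofReal (Real.exp (-(b / 2))) * P (A z) :=
        Finset.sum_le_sum fun z _ =>
          h.measure_path_inter_exceeds_le hF hd hρ (hA z) (hAp z) hb hc z.2
    _ = _ := by
        rw [← Finset.mul_sum, hunion, measure_iUnion hdisj hAm, tsum_fintype]

end IsScenarioUCBRun

end Adaptive

/-- The index of the smallest upper confidence bound is a measurable function of the past. -/
theorem measurableSet_argmin_ucb {α X : Type*} [MeasurableSpace α] [Fintype X] {N : ℕ}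
    {K : α → Fin N → Matrix X X ℝ} (hK : ∀ i x x', Measurable fun a => K a i x x') {ρ b : ℝ}
    {x : ℕ → α → X} {idx : ℕ → α → Fin N} {y : ℕ → α → ℝ} {m : ℕ}
    (hq : ∀ r ∈ Finset.Icc 1 m, ∀ q, MeasurableSet {a | (x r a, idx r a) = q})
    (hy : ∀ r ∈ Finset.Icc 1 m, Measurable (y r)) (x₀ : X) {am : (Fin N → ℝ) → Fin N}
    (ham : ∀ i, MeasurableSet {u | am u = i}) (i : Fin N) :
    MeasurableSet {a | am (fun j => ucb (K a) ρ b (x · a) (idx · a) (y · a) m j x₀) = i} := by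
  classical
  let ex : (Finset.Icc 1 m → X × Fin N) → ℕ → X × Fin N := fun p r =>
    if hr : r ∈ Finset.Icc 1 m then p ⟨r, hr⟩ else (x₀, i)
  have heq : {a | am (fun j => ucb (K a) ρ b (x · a) (idx · a) (y · a) m j x₀) = i} =
      ⋃ p : Finset.Icc 1 m → X × Fin N, (⋂ r : Finset.Icc 1 m, {a | (x r a, idx r a) = p r}) ∩
        {a | am (fun j => ucb (K a) ρ b (fun r => (ex p r).1) (fun r => (ex p r).2) (y · a) m j x₀)
          = i} := by
    ext a
    have hcongr : ∀ p : Finset.Icc 1 m → X × Fin N, (∀ r : Finset.Icc 1 m,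
        (x r a, idx r a) = p r) →
        (fun j => ucb (K a) ρ b (x · a) (idx · a) (y · a) m j x₀) =
          fun j => ucb (K a) ρ b (fun r => (ex p r).1) (fun r => (ex p r).2) (y · a) m j x₀ := by
      intro p hp
      ext j
      have hex : ∀ r ∈ Finset.Icc 1 m, (x r a, idx r a) = ex p r := fun r hr => by
        simp only [ex, dif_pos hr]
        exact hp ⟨r, hr⟩
      have hobs : obsTimes (idx · a) m j = obsTimes (fun r => (ex p r).2) m j :=
        obsTimes_congr (fun r hr => by rw [← hex r hr]) j
      have hpts : ∀ r ∈ obsTimes (fun r => (ex p r).2) m j, x r a = (ex p r).1 := fun r hr => by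
        rw [← hex r (Finset.mem_filter.mp hr).1]
      rw [ucb, ucb, hobs, postMean_congr _ _ hpts (fun _ _ => rfl), postStd_congr _ _ hpts]
    simp only [Set.mem_ofPred_eq, Set.mem_iUnion, Set.mem_inter_iff, Set.mem_iInter]
    constructor
    · intro ha
      refine ⟨fun r => (x r a, idx r a), fun r => rfl, ?_⟩
      rw [← hcongr _ fun r => rfl]
      exact ha
    · rintro ⟨p, hp, ha⟩
      rw [hcongr p hp]
      exact ha
  rw [heq]
  refine MeasurableSet.iUnion fun p =>
    (MeasurableSet.iInter fun r : Finset.Icc 1 m => hq r.1 r.2 (p r)).inter ?_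
  have hm : Measurable fun a j =>
      ucb (K a) ρ b (fun r => (ex p r).1) (fun r => (ex p r).2) (y · a) m j x₀ :=
    measurable_pi_lambda _ fun j =>
      (measurable_postMean (hK j) ρ _ _ (fun r hr => hy r (Finset.mem_filter.mp hr).1) x₀).add
        ((measurable_postStd (hK j) ρ _ _ x₀).const_mul _)
  exact hm (ham i)

/-! ### The confidence parameters -/

section Beta

variable {X : Type*} [Fintype X] [Nonempty X] {ε : ℝ}

theorem one_le_card_mul_div (hε : 0 < ε) (hε1 : ε < 1) {t : ℕ} (ht : 1 ≤ t) :
    1 ≤ Fintype.card X * Real.pi ^ 2 * (t : ℝ) ^ 2 / (3 * ε) := by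
  have hX : (1 : ℝ) ≤ Fintype.card X := by exact_mod_cast Fintype.card_pos
  have ht' : (1 : ℝ) ≤ t := by exact_mod_cast ht
  have hpi := Real.pi_gt_three
  rw [le_div_iff₀ (by positivity)]
  have h1 : (9 : ℝ) ≤ Real.pi ^ 2 := by nlinarith
  have h2 : (1 : ℝ) ≤ (t : ℝ) ^ 2 := one_le_pow₀ ht'
  have h3 : (9 : ℝ) ≤ Fintype.card X * Real.pi ^ 2 := by nlinarith
  nlinarith

theorem beta_nonneg (hε : 0 < ε) (hε1 : ε < 1) {t : ℕ} (ht : 1 ≤ t) : 0 ≤ beta X ε t :=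
  mul_nonneg zero_le_two (Real.log_nonneg (one_le_card_mul_div hε hε1 ht))

theorem beta_mono (hε : 0 < ε) {t T : ℕ} (ht : 1 ≤ t) (h : t ≤ T) :
    beta X ε t ≤ beta X ε T := by
  have hX : (0 : ℝ) < Fintype.card X := by exact_mod_cast Fintype.card_pos
  have ht' : (0 : ℝ) < t := by exact_mod_cast ht
  have hpi := Real.pi_pos
  unfold beta
  gcongr

theorem exp_neg_beta_div_two (hε : 0 < ε) {t : ℕ} (ht : 1 ≤ t) :
    Real.exp (-(beta X ε t / 2)) = 3 * ε / (Fintype.card X * Real.pi ^ 2) * (1 / (t : ℝ) ^ 2) := by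
  have hX : (0 : ℝ) < Fintype.card X := by exact_mod_cast Fintype.card_pos
  have ht' : (0 : ℝ) < t := by exact_mod_cast ht
  have hpi := Real.pi_pos
  rw [beta, mul_div_cancel_left₀ _ two_ne_zero, Real.exp_neg, Real.exp_log (by positivity)]
  field_simp

/-- The choice of `β_t` makes `|X| + 1` one-sided bounds per round affordable: the failure
probabilities add up to at most `(|X| + 1) / (2 |X|) · ε ≤ ε`, by `∑ 1 / t² = π² / 6`. -/
theorem sum_exp_neg_beta_le (hε : 0 < ε) (T : ℕ) :
    ∑ t ∈ Finset.Icc 1 T, (Fintype.card X + 1) * Real.exp (-(beta X ε t / 2)) ≤ ε := by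
  have hX : (1 : ℝ) ≤ Fintype.card X := by exact_mod_cast Fintype.card_pos
  have hpi := Real.pi_pos
  rw [← Finset.mul_sum, Finset.sum_congr rfl fun t ht =>
    exp_neg_beta_div_two hε (Finset.mem_Icc.mp ht).1, ← Finset.mul_sum]
  have hsum : ∑ t ∈ Finset.Icc 1 T, 1 / (t : ℝ) ^ 2 ≤ Real.pi ^ 2 / 6 :=
    sum_le_hasSum _ (fun _ _ => by positivity) hasSum_zeta_two
  calc ((Fintype.card X : ℝ) + 1) * (3 * ε / (Fintype.card X * Real.pi ^ 2) *
        ∑ t ∈ Finset.Icc 1 T, 1 / (t : ℝ) ^ 2)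
      ≤ (Fintype.card X + Fintype.card X) * (3 * ε / (Fintype.card X * Real.pi ^ 2) *
        (Real.pi ^ 2 / 6)) := by gcongr
    _ = ε := by field_simp; norm_num

end Beta

/-! ### The regret bound -/

section Regret

variable {X Δ Ω S : Type*} [Fintype X] {N : ℕ}
  {F : X → Δ × Ω → ℝ} {k : Δ → Matrix X X ℝ} {ρ ε : ℝ}
  {d : Fin N → S → Δ × Ω} {noise : ℕ → S → ℝ}
  {x : ℕ → S → X} {idx : ℕ → S → Fin N} {y : ℕ → S → ℝ}

/-- By Cauchy–Schwarz, regrets below twice the width of the confidence bands sum up to a quantity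
controlled by the information gain. -/
theorem regret_le_of_le_postStd [DecidableEq X] [Nonempty X]
    (hρ : 0 < ρ) (hε : 0 < ε) (hε1 : ε < 1) (hk : ∀ δ, (k δ).PosSemidef) {T : ℕ} (hT : 1 ≤ T)
    (s : S) (hs : ∀ t ∈ Finset.Icc 1 T,
      scenarioValue F (fun i => d i s) - F (x t s) (d (idx t s) s) ≤
      2 * √(beta X ε t) * postStd (k (d (idx t s) s).1) ρ (obsTimes (idx · s) (t - 1) (idx t s))
        (x · s) (x t s)) :
    regret F (fun i => d i s) (x · s) (idx · s) T ≤
      √(8 * beta X ε T * (∑ i, varFactor (k (d i s).1) * maxInfoGain (k (d i s).1) ρ T) /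
        (T * Real.log (1 + 1 / ρ ^ 2))) := by
  set σ : ℕ → ℝ := fun t => postStd (k (d (idx t s) s).1) ρ
    (obsTimes (idx · s) (t - 1) (idx t s)) (x · s) (x t s) with hσ
  set Γ := ∑ i, varFactor (k (d i s).1) * maxInfoGain (k (d i s).1) ρ T
  set L := Real.log (1 + 1 / ρ ^ 2)
  have hL : 0 < L := Real.log_pos (by simp; positivity)
  have hT' : (0 : ℝ) < T := by exact_mod_cast hT
  have hβ := beta_nonneg (X := X) hε hε1 hT
  have hσ0 : ∀ t, 0 ≤ σ t := fun t => Real.sqrt_nonneg _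
  have hvar : (∑ t ∈ Finset.Icc 1 T, σ t ^ 2) * L ≤ 2 * Γ :=
    sum_postStd_sq_le (K := fun i => k (d i s).1) (fun i => hk _) hρ (x · s) (idx · s) T
  have hcs : (∑ t ∈ Finset.Icc 1 T, σ t) ^ 2 ≤ T * ∑ t ∈ Finset.Icc 1 T, σ t ^ 2 := by
    simpa using sq_sum_le_card_mul_sum_sq (s := Finset.Icc 1 T) (f := σ)
  have hlin : regret F (fun i => d i s) (x · s) (idx · s) T ≤
      1 / T * (2 * √(beta X ε T) * ∑ t ∈ Finset.Icc 1 T, σ t) := by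
    refine mul_le_mul_of_nonneg_left ?_ (by positivity)
    rw [Finset.mul_sum]
    refine Finset.sum_le_sum fun t ht => ?_
    refine (hs t ht).trans ?_
    have := beta_mono (X := X) hε (Finset.mem_Icc.mp ht).1 (Finset.mem_Icc.mp ht).2
    gcongr
    exact hσ0 t
  refine hlin.trans (Real.le_sqrt_of_sq_le ?_)
  rw [le_div_iff₀ (by positivity), mul_pow, mul_pow, mul_pow, Real.sq_sqrt hβ]
  calc (1 / (T : ℝ)) ^ 2 * (2 ^ 2 * beta X ε T * (∑ t ∈ Finset.Icc 1 T, σ t) ^ 2) * (T * L)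
      ≤ (1 / (T : ℝ)) ^ 2 * (2 ^ 2 * beta X ε T * (T * ∑ t ∈ Finset.Icc 1 T, σ t ^ 2)) *
        (T * L) := by gcongr
    _ = 4 * beta X ε T * ((∑ t ∈ Finset.Icc 1 T, σ t ^ 2) * L) := by field_simp; ring
    _ ≤ 4 * beta X ε T * (2 * Γ) := by gcongr
    _ = 8 * beta X ε T * Γ := by ring

variable [MeasurableSpace Δ]

namespace IsScenarioUCBRun

/-- On the confidence event the regret of a round is at most twice the width of the confidence band.
The upper bound is only needed, at each point `x₀`, for a scenario `j x₀` that minimises the upper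
confidence bound. -/
theorem instantaneous_regret_le [Nonempty X] (h : IsScenarioUCBRun F k ρ ε d noise x idx y)
    {t : ℕ} (ht : 1 ≤ t) (s : S) (j : X → Fin N)
    (hj : ∀ x₀ i, ucb (fun i => k (d i s).1) ρ (beta X ε t) (x · s) (idx · s) (y · s) (t - 1)
        (j x₀) x₀ ≤
      ucb (fun i => k (d i s).1) ρ (beta X ε t) (x · s) (idx · s) (y · s) (t - 1) i x₀)
    (hup : ∀ x₀, s ∉ exceeds F k ρ d x idx y (t - 1) (beta X ε t) 1 (x₀, j x₀))
    (hlo : s ∉ exceeds F k ρ d x idx y (t - 1) (beta X ε t) (-1) (x t s, idx t s)) :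
    scenarioValue F (fun i => d i s) - F (x t s) (d (idx t s) s) ≤
      2 * √(beta X ε t) * postStd (k (d (idx t s) s).1) ρ (obsTimes (idx · s) (t - 1) (idx t s))
        (x · s) (x t s) := by
  have : Nonempty (Fin N) := ⟨idx t s⟩
  have hJ : scenarioValue F (fun i => d i s) ≤
      ucb (fun i => k (d i s).1) ρ (beta X ε t) (x · s) (idx · s) (y · s) (t - 1) (idx t s)
        (x t s) := by
    refine ciSup_le fun x₀ => ?_
    have h1 := hup x₀
    simp only [exceeds, Set.mem_ofPred_eq, not_lt, one_mul] at h1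
    calc ⨅ i, F x₀ (d i s) ≤ F x₀ (d (j x₀) s) := ciInf_le (Set.finite_range _).bddBelow _
      _ ≤ ucb (fun i => k (d i s).1) ρ (beta X ε t) (x · s) (idx · s) (y · s) (t - 1)
          (j x₀) x₀ := by
        rw [ucb]; linarith
      _ ≤ ⨅ i, ucb (fun i => k (d i s).1) ρ (beta X ε t) (x · s) (idx · s) (y · s) (t - 1) i x₀ :=
        le_ciInf (hj x₀)
      _ ≤ _ := h.argmax_x t ht s x₀
      _ ≤ _ := ciInf_le (Set.finite_range _).bddBelow _
  simp only [exceeds, Set.mem_ofPred_eq, not_lt] at hlo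
  rw [ucb] at hJ
  linarith

variable [MeasurableSpace Ω] [MeasurableSpace S] {P : Measure S} [IsProbabilityMeasure P]
  {Pδ : Measure Δ} [IsProbabilityMeasure Pδ] {κ : Kernel Δ Ω} [IsMarkovKernel κ]

/-- The regret bound with `γ` equal to `varFactor` times the maximal information gain. -/
theorem measure_regret_le [DecidableEq X] [Nonempty X]
    (h : IsScenarioUCBRun F k ρ ε d noise x idx y) (hF : IsRobustGP F k κ)
    (hd : IsScenarioSample P Pδ κ ρ d noise) (hN : 1 ≤ N) (hρ : 0 < ρ) (hε : 0 < ε) (hε1 : ε < 1)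
    {T : ℕ} (hT : 1 ≤ T) {B : Set (Fin N → Δ)} (hB : MeasurableSet B) :
    (1 - ε) * P.real {s | (fun i => (d i s).1) ∈ B} ≤
      P.real {s | (fun i => (d i s).1) ∈ B ∧
        regret F (fun i => d i s) (x · s) (idx · s) T ≤
          √(8 * beta X ε T * (∑ i, varFactor (k (d i s).1) * maxInfoGain (k (d i s).1) ρ T) /
            (T * Real.log (1 + 1 / ρ ^ 2)))} := by
  obtain ⟨am, ham, ham'⟩ := exists_measurable_argmin hN
  -- The scenario with the smallest upper confidence bound at `x₀` in round `t`.
  let j : ℕ → X → S → Fin N := fun t x₀ s => am fun i =>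
    ucb (fun i => k (d i s).1) ρ (beta X ε t) (x · s) (idx · s) (y · s) (t - 1) i x₀
  let up : ℕ → X → Set S := fun t x₀ => {s | (fun i => (d i s).1) ∈ B ∧
    s ∈ exceeds F k ρ d x idx y (t - 1) (beta X ε t) 1 (x₀, j t x₀ s)}
  let lo : ℕ → Set S := fun t => {s | (fun i => (d i s).1) ∈ B ∧
    s ∈ exceeds F k ρ d x idx y (t - 1) (beta X ε t) (-1) (x t s, idx t s)}
  set PB := P.real {s | (fun i => (d i s).1) ∈ B} with hPB
  set G := {s | (fun i => (d i s).1) ∈ B ∧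
    regret F (fun i => d i s) (x · s) (idx · s) T ≤
      √(8 * beta X ε T * (∑ i, varFactor (k (d i s).1) * maxInfoGain (k (d i s).1) ρ T) /
        (T * Real.log (1 + 1 / ρ ^ 2)))}
  have hreal : ∀ {A : Set S} {u : ℝ},
      P A ≤ ENNReal.ofReal (Real.exp u) * P {s | (fun i => (d i s).1) ∈ B} →
      P.real A ≤ Real.exp u * PB := fun {A u} hA => by
    have := ENNReal.toReal_mono (by finiteness) hA
    rwa [ENNReal.toReal_mul, ENNReal.toReal_ofReal (Real.exp_pos u).le] at this
  have hup : ∀ t ∈ Finset.Icc 1 T, ∀ x₀,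
      P.real (up t x₀) ≤ Real.exp (-(beta X ε t / 2)) * PB := fun t ht x₀ => by
    obtain ⟨t, rfl⟩ : ∃ m, t = m + 1 := ⟨t - 1, by have := (Finset.mem_Icc.mp ht).1; omega⟩
    refine hreal (h.measure_exceeds_le hF hd hρ t (sel := fun s => (x₀, j (t + 1) x₀ s))
      (fun q => ?_) hB (beta_nonneg hε hε1 (Nat.le_add_left 1 t)) (by norm_num))
    have hj : MeasurableSet[history d y (t + 1)] {s | j (t + 1) x₀ s = q.2} :=
      @measurableSet_argmin_ucb S X (history d y (t + 1)) _ N (fun s i => k (d i s).1)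
        (fun i a a' => (hF.measurable_kernel a a').comp
          ((measurable_pi_apply i).comp (measurable_history_fst d y (t + 1))))
        ρ (beta X ε (t + 1)) x idx y t
        (fun r hr q => history_mono d y
          (by have := (Finset.mem_Icc.mp hr).2; omega) _
          (h.measurableSet_query_eq (Finset.mem_Icc.mp hr).1 q))
        (fun r hr => measurable_history_obs d y hr) x₀ am ham' q.2
    by_cases hq : x₀ = q.1
    · convert hj using 1
      ext s
      simp [Prod.ext_iff, hq]
    · convert MeasurableSet.empty using 1
      ext s
      simp [Prod.ext_iff, hq]
  have hlo : ∀ t ∈ Finset.Icc 1 T, P.real (lo t) ≤ Real.exp (-(beta X ε t / 2)) * PB :=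
      fun t ht => by
    obtain ⟨t, rfl⟩ : ∃ m, t = m + 1 := ⟨t - 1, by have := (Finset.mem_Icc.mp ht).1; omega⟩
    exact hreal (h.measure_exceeds_le hF hd hρ t (sel := fun s => (x (t + 1) s, idx (t + 1) s))
      (fun q => h.measurableSet_query_eq (Nat.le_add_left 1 t) q) hB
      (beta_nonneg hε hε1 (Nat.le_add_left 1 t)) (by norm_num))
  have hcover : {s | (fun i => (d i s).1) ∈ B} ⊆
      G ∪ ⋃ t ∈ Finset.Icc 1 T, ((⋃ x₀, up t x₀) ∪ lo t) := by
    intro s hs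
    by_contra hcon
    simp only [Set.mem_union, Set.mem_iUnion, not_or, not_exists] at hcon
    refine hcon.1 ⟨hs, regret_le_of_le_postStd hρ hε hε1 hF.posSemidef_kernel hT s fun t ht => ?_⟩
    exact h.instantaneous_regret_le (Finset.mem_Icc.mp ht).1 s (fun x₀ => j t x₀ s)
      (fun x₀ i => ham (fun i => ucb (fun i => k (d i s).1) ρ (beta X ε t) (x · s) (idx · s) (y · s)
        (t - 1) i x₀) i) (fun x₀ hx => (hcon.2 t ht).1 x₀ ⟨hs, hx⟩)
      (fun hx => (hcon.2 t ht).2 ⟨hs, hx⟩)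
  have hround : ∀ t ∈ Finset.Icc 1 T, P.real ((⋃ x₀, up t x₀) ∪ lo t) ≤
      (Fintype.card X + 1) * Real.exp (-(beta X ε t / 2)) * PB := fun t ht => by
    have h1 : P.real (⋃ x₀, up t x₀) ≤ ∑ _x₀ : X, Real.exp (-(beta X ε t / 2)) * PB :=
      (measureReal_iUnion_fintype_le _).trans (Finset.sum_le_sum fun x₀ _ => hup t ht x₀)
    rw [Finset.sum_const, Finset.card_univ, nsmul_eq_mul] at h1
    have := (measureReal_union_le (μ := P) (⋃ x₀, up t x₀) (lo t)).trans
      (add_le_add h1 (hlo t ht))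
    linarith
  have hbad : P.real (⋃ t ∈ Finset.Icc 1 T, ((⋃ x₀, up t x₀) ∪ lo t)) ≤ ε * PB :=
    (measureReal_biUnion_finset_le _ _).trans <| (Finset.sum_le_sum hround).trans <| by
      rw [← Finset.sum_mul]
      exact mul_le_mul_of_nonneg_right (sum_exp_neg_beta_le hε T) measureReal_nonneg
  have := (measureReal_mono (μ := P) hcover).trans (measureReal_union_le _ _)
  linarith

end IsScenarioUCBRun

end Regret

end ScenarioUCB

open ScenarioUCB in
theorem theorem3 (ρ₀ : ℝ) (hρ₀ : 0 < ρ₀) :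
    -- `C₁` depends only on an upper bound `ρ₀` for the noise level, `C₂` only on the noise level
    ∃ C₁ : ℝ, ∀ ρ : ℝ, 0 < ρ → ρ ≤ ρ₀ → ∃ C₂ : ℝ,
    ∀ (X : Type*) [Fintype X] [DecidableEq X] [Nonempty X],
    -- `γ K T` depends only on the kernel matrix `K`, on `T` (and on `ρ`)
    ∃ γ : Matrix X X ℝ → ℕ → ℝ,
      (∀ (K : Matrix X X ℝ) (hK : K.PosSemidef) (T : ℕ), 1 ≤ T →
        γ K T ≤ C₁ * varFactor K * (ρ⁻¹ ^ 2 *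
          (T * eigTail hK.isHermitian + Real.log (max 2 (T * eigSum hK.isHermitian))))) ∧
      (∀ (K : Matrix X X ℝ) (hK : K.PosSemidef) (T : ℕ), Fintype.card X < T →
        γ K T ≤ C₂ * varFactor K *
          (Fintype.card X * Real.log (max 2 (T * eigSum hK.isHermitian)))) ∧
      ∀ (Δ Ω S : Type*) [MeasurableSpace Δ] [MeasurableSpace Ω] [MeasurableSpace S]
        (P : Measure S) [IsProbabilityMeasure P]
        (Pδ : Measure Δ) [IsProbabilityMeasure Pδ] (κ : Kernel Δ Ω) [IsMarkovKernel κ]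
        (F : X → Δ × Ω → ℝ) (k : Δ → Matrix X X ℝ)
        (N : ℕ) (d : Fin N → S → Δ × Ω) (noise : ℕ → S → ℝ) (ε : ℝ)
        (x : ℕ → S → X) (idx : ℕ → S → Fin N) (y : ℕ → S → ℝ),
        1 ≤ N → 0 < ε → ε < 1 →
        IsRobustGP F k κ → IsScenarioSample P Pδ κ ρ d noise →
        IsScenarioUCBRun F k ρ ε d noise x idx y →
        -- the bound holds with probability at least `1 - ε` conditionally on `(δ_1, …, δ_N)`
        ∀ T : ℕ, 1 ≤ T → ∀ B : Set (Fin N → Δ), MeasurableSet B →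
          (1 - ε) * P.real {s | (fun i => (d i s).1) ∈ B} ≤
            P.real {s | (fun i => (d i s).1) ∈ B ∧
              regret F (fun i => d i s) (x · s) (idx · s) T ≤
                √(8 * beta X ε T * (∑ i, γ (k (d i s).1) T) /
                  (T * Real.log (1 + 1 / ρ ^ 2)))} := by
  refine ⟨1 + (Real.log 2)⁻¹ + ρ₀ ^ 2, fun ρ hρ hρρ₀ =>
    ⟨Real.log (1 + (ρ ^ 2)⁻¹) / Real.log 2 + 1, fun X _ _ _ =>
      ⟨fun K T => varFactor K * maxInfoGain K ρ T, fun K hK T _ => ?_, fun K hK T _ => ?_, ?_⟩⟩⟩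
  · have := mul_le_mul_of_nonneg_left (maxInfoGain_le_eigTail_add_log hK hρ hρρ₀ T)
      (zero_le_one.trans (one_le_varFactor K))
    linarith
  · have := mul_le_mul_of_nonneg_left (maxInfoGain_le_card_mul_log hK hρ T)
      (zero_le_one.trans (one_le_varFactor K))
    linarith
  · intro Δ Ω S _ _ _ P _ Pδ _ κ _ F k N d noise ε x idx y hN hε hε1 hF hd hrun T hT B hB
    exact hrun.measure_regret_le hF hd hN hρ hε hε1 hT hB
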